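/- Let $N$ be a natural number and let $\mathrm{d}U$ be Haar measure of total mass one on the unitary group $\mathrm{U}(N)$. For a Young diagram $\lambda$ with $d$ cells (written $\lambda\vdash d$) and $\ell(\lambda)$ rows, let $\mathsf V^\lambda$ be the corresponding irreducible complex representation of the symmetric group $\mathrm{S}(d)$, with character $\chi^\lambda$, and, when $\ell(\lambda)\le N$, let $\mathsf W^\lambda$ be the corresponding irreducible polynomial representation of $\mathrm{GL}_N(\mathbb C)$. Let $$s_\lambda(x_1,\dots,x_N)=\frac1{d!}\sum_{\pi\in \mathrm S(d)}\chi^\lambda(\pi)\,p_{\pi}(x_1,\dots,x_N),\qquad p_\pi(x_1,\dots,x_N)=\prod_{\text{cycles } \gamma \text{ of }\pi}\ \sum_{j=1}^N x_j^{|\gamma|},$$ be the Schur polynomial, where fixed points of $\pi$ count as cycles of length $1$. Then for all $z\in\mathbb C$ and $A,B\in\mathrm{Mat}_N(\mathbb C)$, $$\int_{\mathrm U(N)} e^{zN\operatorname{Tr}AUBU^{-1}}\,\mathrm dU = 1+\sum_{d=1}^\infty \frac{z^d}{d!}N^d\sum_{\substack{\lambda\vdash d\\ \ell(\lambda)\le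 N}} s_\lambda(a_1,\dots,a_N)\,s_\lambda(b_1,\dots,b_N)\,\frac{\dim\mathsf V^\lambda}{\dim\mathsf W^\lambda},$$ $$\int_{\mathrm U(N)} e^{zN\operatorname{Tr}(AU+BU^{-1})}\,\mathrm dU = 1+\sum_{d=1}^\infty \frac{z^{2d}}{d!\,d!}N^{2d}\sum_{\substack{\lambda\vdash d\\ \ell(\lambda)\le N}} s_\lambda(c_1,\dots,c_N)\,\frac{(\dim\mathsf V^\lambda)^2}{\dim\mathsf W^\lambda},$$ where $a_1,\dots,a_N$, $b_1,\dots,b_N$ and $c_1,\dots,c_N$ are the eigenvalues, with algebraic multiplicity, of $A$, $B$ and $AB$ respectively. As series of functions of $(z,a_1,\dots,a_N,b_1,\dots,b_N)\in\mathbb C^{2N+1}$ and of $(z,c_1,\dots,c_N)\in\mathbb C^{N+1}$ respectively, they converge absolutely, and uniformly on compact subsets; this holds both for the series indexed by $d$ and, with the inner sums expanded, for the series indexed by all Young diagrams $\lambda$ with $\ell(\lambda)\le N$, for which the series of absolute values also converges uniformly on compact subsets. -/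

import Mathlib

open scoped TensorProduct

noncomputable section

namespace CharExp

/-! ### Young diagrams and irreducible representations of the symmetric groups -/

/-- The number of rows of a Young diagram. -/
def numRows (lam : YoungDiagram) : ℕ := lam.colLen 0

theorem finite_diagrams (N d : ℕ) :
    {lam : YoungDiagram | lam.card = d ∧ numRows lam ≤ N}.Finite := by
  have hinj : Function.Injective (YoungDiagram.cells) := fun a b h => YoungDiagram.ext h
  refine Set.Finite.subset (Set.Finite.preimage hinj.injOn
    ((Finset.range d ×ˢ Finset.range d).powerset.finite_toSet)) ?_
  rintro lam ⟨hd, -⟩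
  simp only [Set.mem_preimage, Finset.mem_coe, Finset.mem_powerset]
  rintro ⟨i, j⟩ hij
  have hij' : (i, j) ∈ lam := hij
  have h1 : lam.colLen j ≤ d := by
    rw [lam.colLen_eq_card, ← hd]
    exact Finset.card_le_card (Finset.filter_subset _ _)
  have h2 : lam.rowLen i ≤ d := by
    rw [lam.rowLen_eq_card, ← hd]
    exact Finset.card_le_card (Finset.filter_subset _ _)
  simp only [Finset.mem_product, Finset.mem_range]
  exact ⟨(YoungDiagram.mem_iff_lt_colLen.1 hij').trans_le h1,
    (YoungDiagram.mem_iff_lt_rowLen.1 hij').trans_le h2⟩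

/-- The finite set of Young diagrams with `d` cells and at most `N` rows. -/
def diagrams (N d : ℕ) : Finset YoungDiagram := (finite_diagrams N d).toFinset

/-- Permutations preserving every row of the numbering `t` of the cells of `lam`. -/
def rowPerms {d : ℕ} {lam : YoungDiagram} (t : lam.cells ≃ Fin d) :
    Finset (Equiv.Perm (Fin d)) :=
  Finset.univ.filter fun g => ∀ k, (t.symm (g k)).1.1 = (t.symm k).1.1

/-- Permutations preserving every column of the numbering `t` of the cells of `lam`. -/
def colPerms {d : ℕ} {lam : YoungDiagram} (t : lam.cells ≃ Fin d) :
    Finset (Equiv.Perm (Fin d)) :=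
  Finset.univ.filter fun g => ∀ k, (t.symm (g k)).1.2 = (t.symm k).1.2

/-- The Young symmetrizer of the numbering `t`: the sum of the row permutations times the signed
sum of the column permutations. -/
def youngSymmetrizer {d : ℕ} {lam : YoungDiagram} (t : lam.cells ≃ Fin d) :
    MonoidAlgebra ℂ (Equiv.Perm (Fin d)) :=
  (∑ g ∈ rowPerms t, MonoidAlgebra.single g 1) *
    ∑ g ∈ colPerms t, MonoidAlgebra.single g ((Equiv.Perm.sign g : ℤ) : ℂ)

/-- A numbering of the cells of `lam`. The representations below do not depend, up to isomorphism,
on which numbering is taken. -/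
def numbering (lam : YoungDiagram) : lam.cells ≃ Fin lam.card := lam.cells.equivFin

/-- The irreducible `S(d)`-module `V^lam` (`d` the number of cells of `lam`): the left ideal of the
group algebra generated by the Young symmetrizer. -/
def V (lam : YoungDiagram) :
    Submodule (MonoidAlgebra ℂ (Equiv.Perm (Fin lam.card)))
      (MonoidAlgebra ℂ (Equiv.Perm (Fin lam.card))) :=
  Submodule.span _ {youngSymmetrizer (numbering lam)}

/-- The representation of the symmetric group on `V lam`, by left multiplication. -/
def Vrep (lam : YoungDiagram) : Representation ℂ (Equiv.Perm (Fin lam.card)) (V lam) :=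
  (Algebra.lsmul ℂ ℂ (V lam)).toMonoidHom.comp
    (MonoidAlgebra.of ℂ (Equiv.Perm (Fin lam.card)))

/-- `dim V^lam`. -/
def dimV (lam : YoungDiagram) : ℕ := Module.finrank ℂ (V lam)

/-! ### Schur polynomials -/

/-- The Schur polynomial in `N` variables: the normalised sum over the symmetric group of the
irreducible character times the power sum polynomial of the cycle type (fixed points included). -/
def schur (N : ℕ) (lam : YoungDiagram) : MvPolynomial (Fin N) ℂ :=
  MvPolynomial.C ((lam.card.factorial : ℂ)⁻¹) *
    ∑ g : Equiv.Perm (Fin lam.card),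
      MvPolynomial.C ((Vrep lam).character g) * MvPolynomial.psumPart (Fin N) ℂ g.partition

/-! ### Irreducible polynomial representations of the general linear groups -/

/-- The `d`-th tensor power of `ℂ^N`. -/
abbrev TensorPow (N d : ℕ) : Type := ⨂[ℂ] _ : Fin d, (Fin N → ℂ)

/-- The action of `S(d)` on tensors by permutation of the factors. -/
def permRep (N d : ℕ) : Representation ℂ (Equiv.Perm (Fin d)) (TensorPow N d) where
  toFun g := (PiTensorProduct.reindex ℂ (fun _ => Fin N → ℂ) g).toLinearMap
  map_one' := by
    ext x
    simp
    rfl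
  map_mul' g h := by
    ext x
    simp
    rfl

/-- The diagonal action of `GL_N(ℂ)` on tensors. -/
def glRep (N d : ℕ) : Representation ℂ (Matrix.GeneralLinearGroup (Fin N) ℂ) (TensorPow N d) where
  toFun g := PiTensorProduct.map fun _ => Matrix.toLin' (g : Matrix (Fin N) (Fin N) ℂ)
  map_one' := by
    ext x
    simp
  map_mul' g h := by
    ext x
    simp

theorem glRep_comm (N d : ℕ) (g : Matrix.GeneralLinearGroup (Fin N) ℂ)
    (c : MonoidAlgebra ℂ (Equiv.Perm (Fin d))) :
    glRep N d g ∘ₗ (permRep N d).asAlgebraHom c = (permRep N d).asAlgebraHom c ∘ₗ glRep N d g := by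
  induction c using MonoidAlgebra.induction_on with
  | of h =>
    ext x
    simp [glRep, permRep, PiTensorProduct.reindex_tprod]
  | add a b ha hb => rw [map_add, LinearMap.comp_add, LinearMap.add_comp, ha, hb]
  | smul r a ha => rw [map_smul, LinearMap.comp_smul, LinearMap.smul_comp, ha]

/-- The polynomial representation `W^lam` of `GL_N(ℂ)`: the image of the Young symmetrizer acting on
tensors. It is irreducible when `lam` has at most `N` rows, and zero otherwise. -/
def W (N : ℕ) (lam : YoungDiagram) : Subrepresentation (glRep N lam.card) where
  toSubmodule :=
    LinearMap.range ((permRep N lam.card).asAlgebraHom (youngSymmetrizer (numbering lam)))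
  apply_mem_toSubmodule g v := by
    rintro ⟨w, rfl⟩
    exact ⟨glRep N lam.card g w, (LinearMap.congr_fun (glRep_comm N lam.card g _) w).symm⟩

/-- `dim W^lam`. -/
def dimW (N : ℕ) (lam : YoungDiagram) : ℕ := Module.finrank ℂ (W N lam).toSubmodule

/-! ### The unitary group and its Haar measure -/

/-- `U(N)`. -/
abbrev U (N : ℕ) : Type := Matrix.unitaryGroup (Fin N) ℂ

instance instMeasurableSpaceU (N : ℕ) : MeasurableSpace (U N) := borel _

instance instBorelSpaceU (N : ℕ) : BorelSpace (U N) := ⟨rfl⟩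

instance instCompactSpaceU (N : ℕ) : CompactSpace (U N) := by
  refine isCompact_iff_compactSpace.1 ?_
  have hc : IsCompact (Set.univ.pi fun _ : Fin N => Set.univ.pi fun _ : Fin N =>
      Metric.closedBall (0 : ℂ) 1) :=
    isCompact_univ_pi fun _ => isCompact_univ_pi fun _ => isCompact_closedBall _ _
  refine hc.of_isClosed_subset (isClosed_unitary (R := Matrix (Fin N) (Fin N) ℂ)) ?_
  intro M hM
  simp only [Set.mem_pi, Set.mem_univ, forall_true_left, mem_closedBall_zero_iff]
  exact fun i j => entry_norm_bound_of_unitary hM i j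

/-- Haar measure on `U(N)` of total mass one. -/
def haarU (N : ℕ) : MeasureTheory.Measure (U N) := MeasureTheory.Measure.haarMeasure ⊤

/-! ### The two integrals and the terms of their expansions -/

/-- The HCIZ integral. -/
def hciz (N : ℕ) (z : ℂ) (A B : Matrix (Fin N) (Fin N) ℂ) : ℂ :=
  ∫ u : U N, Complex.exp (z * N *
    (A * (u : Matrix (Fin N) (Fin N) ℂ) * B * ((u⁻¹ : U N) : Matrix (Fin N) (Fin N) ℂ)).trace)
      ∂(haarU N)

/-- The BGW integral. -/
def bgw (N : ℕ) (z : ℂ) (A B : Matrix (Fin N) (Fin N) ℂ) : ℂ :=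
  ∫ u : U N, Complex.exp (z * N *
    (A * (u : Matrix (Fin N) (Fin N) ℂ) + B * ((u⁻¹ : U N) : Matrix (Fin N) (Fin N) ℂ)).trace)
      ∂(haarU N)

/-- `a_1, …, a_N` are the eigenvalues of `A`, with algebraic multiplicity. -/
def AreEigenvalues {N : ℕ} (A : Matrix (Fin N) (Fin N) ℂ) (a : Fin N → ℂ) : Prop :=
  A.charpoly.roots = Finset.univ.val.map a

/-- The contribution of a single Young diagram to the HCIZ expansion, at the point `(z, a, b)`. -/
def hcizDiagramTerm (N : ℕ) (lam : YoungDiagram) (p : ℂ × (Fin N → ℂ) × (Fin N → ℂ)) : ℂ :=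
  p.1 ^ lam.card / (lam.card.factorial : ℂ) * (N : ℂ) ^ lam.card *
    (MvPolynomial.eval p.2.1 (schur N lam) * MvPolynomial.eval p.2.2 (schur N lam) *
      ((dimV lam : ℂ) / (dimW N lam : ℂ)))

/-- The degree `d` term of the HCIZ expansion, at the point `(z, a, b)`. -/
def hcizTerm (N d : ℕ) (p : ℂ × (Fin N → ℂ) × (Fin N → ℂ)) : ℂ :=
  p.1 ^ d / (d.factorial : ℂ) * (N : ℂ) ^ d *
    ∑ lam ∈ diagrams N d,
      MvPolynomial.eval p.2.1 (schur N lam) * MvPolynomial.eval p.2.2 (schur N lam) *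
        ((dimV lam : ℂ) / (dimW N lam : ℂ))

/-- The contribution of a single Young diagram to the BGW expansion, at the point `(z, c)`. -/
def bgwDiagramTerm (N : ℕ) (lam : YoungDiagram) (p : ℂ × (Fin N → ℂ)) : ℂ :=
  p.1 ^ (2 * lam.card) / ((lam.card.factorial : ℂ) * (lam.card.factorial : ℂ)) *
    (N : ℂ) ^ (2 * lam.card) *
    (MvPolynomial.eval p.2 (schur N lam) * ((dimV lam : ℂ) ^ 2 / (dimW N lam : ℂ)))

/-- The degree `2d` term of the BGW expansion, at the point `(z, c)`. -/
def bgwTerm (N d : ℕ) (p : ℂ × (Fin N → ℂ)) : ℂ :=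
  p.1 ^ (2 * d) / ((d.factorial : ℂ) * (d.factorial : ℂ)) * (N : ℂ) ^ (2 * d) *
    ∑ lam ∈ diagrams N d,
      MvPolynomial.eval p.2 (schur N lam) * ((dimV lam : ℂ) ^ 2 / (dimW N lam : ℂ))

/-- The series of functions `1 + f 1 + f 2 + ⋯` converges absolutely at every point, and its
partial sums converge uniformly on compact sets. -/
def SeriesConverges {X : Type*} [TopologicalSpace X] (f : ℕ → X → ℂ) : Prop :=
  (∀ p, Summable fun d => ‖f (d + 1) p‖) ∧
    ∀ K : Set X, IsCompact K →
      TendstoUniformlyOn (fun n p => 1 + ∑ d ∈ Finset.range n, f (d + 1) p)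
        (fun p => 1 + ∑' d, f (d + 1) p) Filter.atTop K

end CharExp

end

/-!
Expand the exponential under the integral. The degree `d` part is governed by the average over
`U(N)` of an operator on `(ℂᴺ)^{⊗d}`. That average commutes with all `u^{⊗d}`, hence, as `U(N)` is
Zariski dense, with the whole image of `GL_N`, so by the double commutant theorem it is the action
of some element of `ℂ[S_d]`, and such an element is pinned down by its traces against permutations.
The central idempotents of `ℂ[S_d]`, built from Young symmetrizers, diagonalize this linear system:
on the block of `λ` the trace form on `(ℂᴺ)^{⊗d}` and the regular trace form differ by the factor
`dim W^λ / dim V^λ`, which is where the ratios of dimensions come from. In the second integral the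
terms of degrees `p ≠ q` in `U` and `U⁻¹` vanish, since Haar measure is invariant under unit
scalars. Convergence follows from `∑ dim V^λ dim W^λ = N^d`.
-/

noncomputable section

namespace CharExp

/-! ### Numberings of Young diagrams -/

section Numberings

variable {α : Type*} {lam mu : YoungDiagram}

/-- The number of cells in the first `k` rows: a partial sum of the row lengths, in terms of which
the dominance order is defined. -/
def firstRows (lam : YoungDiagram) (k : ℕ) : ℕ := (lam.cells.filter fun c => c.1 < k).card

theorem firstRows_succ (lam : YoungDiagram) (k : ℕ) :
    firstRows lam (k + 1) = firstRows lam k + lam.rowLen k := by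
  rw [YoungDiagram.rowLen_eq_card, firstRows, firstRows, ← Finset.card_union_of_disjoint]
  · congr 1
    ext c
    simp only [Finset.mem_filter, YoungDiagram.mem_cells, Finset.mem_union,
      YoungDiagram.mem_row_iff, Order.lt_add_one_iff, le_iff_lt_or_eq]
    tauto
  · rw [Finset.disjoint_left]
    intro c h1 h2
    simp only [Finset.mem_filter, YoungDiagram.mem_row_iff] at h1 h2
    omega

theorem eq_of_firstRows_eq (h : ∀ k, firstRows lam k = firstRows mu k) : lam = mu := by
  have hrow : ∀ k, lam.rowLen k = mu.rowLen k := fun k => by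
    have hsucc := h (k + 1)
    rw [firstRows_succ, firstRows_succ, h k] at hsucc
    exact Nat.add_left_cancel hsucc
  ext ⟨i, j⟩
  simp only [YoungDiagram.mem_cells, YoungDiagram.mem_iff_lt_rowLen, hrow]

theorem snd_lt_rowLen_zero {c : ℕ × ℕ} (hc : c ∈ lam) : c.2 < lam.rowLen 0 :=
  (YoungDiagram.mem_iff_lt_rowLen.1 hc).trans_le (lam.rowLen_anti 0 c.1 (Nat.zero_le _))

theorem card_filter_row_lt_col_eq (lam : YoungDiagram) (k j : ℕ) :
    (lam.cells.filter fun c => c.1 < k ∧ c.2 = j).card = min k (lam.colLen j) := by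
  have himage : (lam.cells.filter fun c => c.1 < k ∧ c.2 = j) =
      (Finset.range (min k (lam.colLen j))).image fun i => (i, j) := by
    ext ⟨i, j'⟩
    simp only [Finset.mem_filter, YoungDiagram.mem_cells, Finset.mem_image, Finset.mem_range,
      lt_min_iff, Prod.mk.injEq]
    constructor
    · rintro ⟨h, hk, rfl⟩
      exact ⟨i, ⟨hk, YoungDiagram.mem_iff_lt_colLen.1 h⟩, rfl, rfl⟩
    · rintro ⟨i, ⟨hk, h⟩, rfl, rfl⟩
      exact ⟨YoungDiagram.mem_iff_lt_colLen.2 h, hk, rfl⟩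
  rw [himage, Finset.card_image_of_injective _ (Prod.mk_left_injective j), Finset.card_range]

theorem firstRows_eq_sum_min_colLen (lam : YoungDiagram) (k : ℕ) :
    firstRows lam k = ∑ j ∈ Finset.range (lam.rowLen 0), min k (lam.colLen j) := by
  rw [firstRows, Finset.card_eq_sum_card_fiberwise (f := Prod.snd)
    (t := Finset.range (lam.rowLen 0))]
  · refine Finset.sum_congr rfl fun j _ => ?_
    rw [← card_filter_row_lt_col_eq, Finset.filter_filter]
  · intro c hc
    exact Finset.mem_coe.2 (Finset.mem_range.2 (snd_lt_rowLen_zero (Finset.mem_filter.1 hc).1))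

/-- The row of the entry `e` in the numbering `t`. -/
def rowOf (t : lam.cells ≃ α) (e : α) : ℕ := (t.symm e).1.1

/-- The column of the entry `e` in the numbering `t`. -/
def colOf (t : lam.cells ≃ α) (e : α) : ℕ := (t.symm e).1.2

theorem rowOf_prod_colOf_injective (t : lam.cells ≃ α) :
    Function.Injective fun e => (rowOf t e, colOf t e) :=
  Subtype.val_injective.comp t.symm.injective

theorem colOf_lt_rowLen_zero (t : lam.cells ≃ α) (e : α) : colOf t e < lam.rowLen 0 :=
  snd_lt_rowLen_zero (t.symm e).2

section Fintype

variable [Fintype α]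

theorem card_filter_rowOf_lt (t : lam.cells ≃ α) (k : ℕ) :
    (Finset.univ.filter fun e => rowOf t e < k).card = firstRows lam k := by
  rw [firstRows, ← Finset.card_map (t.symm.toEmbedding.trans (Function.Embedding.subtype _))]
  congr 1
  ext c
  simp only [Finset.mem_map, Finset.mem_filter, Finset.mem_univ, true_and]
  constructor
  · rintro ⟨e, he, rfl⟩
    exact ⟨(t.symm e).2, he⟩
  · rintro ⟨hc, hk⟩
    exact ⟨t ⟨c, hc⟩, by simpa [rowOf] using hk, by simp⟩

theorem sum_card_filter_rowOf_lt_colOf_eq (t : lam.cells ≃ α) (s : mu.cells ≃ α) (k : ℕ) :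
    ∑ j ∈ Finset.range (mu.rowLen 0),
      (Finset.univ.filter fun e => rowOf t e < k ∧ colOf s e = j).card = firstRows lam k := by
  rw [← card_filter_rowOf_lt t, Finset.card_eq_sum_card_fiberwise (f := colOf s)
    (t := Finset.range (mu.rowLen 0))]
  · exact Finset.sum_congr rfl fun j _ => by rw [Finset.filter_filter]
  · exact fun e _ => Finset.mem_coe.2 (Finset.mem_range.2 (colOf_lt_rowLen_zero s e))

theorem card_filter_rowOf_lt_colOf_eq_le (t : lam.cells ≃ α) (s : mu.cells ≃ α)
    (hinj : Function.Injective fun e => (rowOf t e, colOf s e)) (k j : ℕ) :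
    (Finset.univ.filter fun e => rowOf t e < k ∧ colOf s e = j).card ≤ min k (mu.colLen j) := by
  have hcol : ∀ e ∈ Finset.univ.filter fun e => rowOf t e < k ∧ colOf s e = j, colOf s e = j :=
    fun e he => (Finset.mem_filter.1 he).2.2
  refine le_min ?_ ?_
  · refine (Finset.card_le_card_of_injOn (t := Finset.range k) (rowOf t) (fun e he => ?_)
      fun e he e' he' h => ?_).trans_eq (Finset.card_range k)
    · simpa using (Finset.mem_filter.1 he).2.1
    · exact hinj (Prod.ext h ((hcol e he).trans (hcol e' he').symm))
  · rw [YoungDiagram.colLen_eq_card]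
    exact Finset.card_le_card_of_injOn (fun e => (s.symm e).1)
      (fun e he => YoungDiagram.mem_col_iff.2 ⟨(s.symm e).2, hcol e he⟩)
      (Subtype.val_injective.comp s.symm.injective).injOn

theorem card_filter_rowOf_lt_colOf_eq (t s : lam.cells ≃ α)
    (hinj : Function.Injective fun e => (rowOf t e, colOf s e)) (k : ℕ) {j : ℕ}
    (hj : j < lam.rowLen 0) :
    (Finset.univ.filter fun e => rowOf t e < k ∧ colOf s e = j).card = min k (lam.colLen j) := by
  refine (Finset.sum_eq_sum_iff_of_le
    (fun j _ => card_filter_rowOf_lt_colOf_eq_le t s hinj k j)).1 ?_ _ (Finset.mem_range.2 hj)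
  rw [sum_card_filter_rowOf_lt_colOf_eq t s, firstRows_eq_sum_min_colLen]

end Fintype

theorem firstRows_le_firstRows [Finite α] (t : lam.cells ≃ α) (s : mu.cells ≃ α)
    (hinj : Function.Injective fun e => (rowOf t e, colOf s e)) (k : ℕ) :
    firstRows lam k ≤ firstRows mu k := by
  have := Fintype.ofFinite α
  rw [← sum_card_filter_rowOf_lt_colOf_eq t s, firstRows_eq_sum_min_colLen mu]
  exact Finset.sum_le_sum fun j _ => card_filter_rowOf_lt_colOf_eq_le t s hinj k j

theorem rowOf_prod_colOf_mem [Finite α] (t s : lam.cells ≃ α)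
    (hinj : Function.Injective fun e => (rowOf t e, colOf s e)) (e : α) :
    (rowOf t e, colOf s e) ∈ lam := by
  have := Fintype.ofFinite α
  rw [YoungDiagram.mem_iff_lt_colLen]
  have hlt : (Finset.univ.filter fun e' => rowOf t e' < rowOf t e ∧ colOf s e' = colOf s e).card <
      (Finset.univ.filter fun e' => rowOf t e' < rowOf t e + 1 ∧ colOf s e' = colOf s e).card := by
    refine Finset.card_lt_card (Finset.ssubset_iff_of_subset ?_ |>.2 ⟨e, ?_, ?_⟩)
    · exact Finset.monotone_filter_right _ fun e' _ h => ⟨h.1.trans (Nat.lt_succ_self _), h.2⟩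
    · simp
    · simp
  have hj := colOf_lt_rowLen_zero s e
  rw [card_filter_rowOf_lt_colOf_eq t s hinj _ hj, card_filter_rowOf_lt_colOf_eq t s hinj _ hj]
    at hlt
  omega

/-- The permutations preserving every fibre of `f`. -/
def fiberPerms {β : Type*} (f : α → β) : Subgroup (Equiv.Perm α) where
  carrier := {g | ∀ e, f (g e) = f e}
  mul_mem' hg hh e := (hg _).trans (hh e)
  one_mem' _ := rfl
  inv_mem' {g} hg e := by simpa using (hg (g⁻¹ e)).symm

theorem swap_mem_fiberPerms {β : Type*} [DecidableEq α] {f : α → β} {e e' : α} (h : f e = f e') :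
    Equiv.swap e e' ∈ fiberPerms f := by
  intro x
  rw [Equiv.swap_apply_def]
  split_ifs with h1 h2 <;> simp_all

theorem disjoint_fiberPerms {β γ : Type*} {f : α → β} {f' : α → γ}
    (hinj : Function.Injective fun e => (f e, f' e)) :
    Disjoint (fiberPerms f) (fiberPerms f') :=
  Subgroup.disjoint_def.2 fun hf hf' => Equiv.ext fun e => hinj (Prod.ext (hf e) (hf' e))

theorem exists_eq_mul_of_rowOf_prod_colOf_injective [Finite α] (t : lam.cells ≃ α)
    (g : Equiv.Perm α)
    (hinj : Function.Injective fun e => (rowOf t e, colOf (t.trans g) e)) :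
    ∃ p ∈ fiberPerms (rowOf t), ∃ q ∈ fiberPerms (colOf t), g = p * q := by
  have := Fintype.ofFinite α
  let cell : α → lam.cells := fun e => ⟨_, rowOf_prod_colOf_mem t (t.trans g) hinj e⟩
  have hcell : Function.Bijective cell := (Fintype.bijective_iff_injective_and_card _).2
    ⟨fun e e' h => hinj (congrArg Subtype.val h), (Fintype.card_congr t).symm⟩
  let p : Equiv.Perm α := t.symm.trans (Equiv.ofBijective cell hcell).symm
  have hp : ∀ e, (rowOf t (p e), colOf t (g⁻¹ (p e))) = (rowOf t e, colOf t e) := fun e =>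
    congrArg Subtype.val ((Equiv.ofBijective cell hcell).apply_symm_apply (t.symm e))
  have hq : g⁻¹ * p ∈ fiberPerms (colOf t) := fun e => (Prod.ext_iff.1 (hp e)).2
  refine ⟨p, fun e => (Prod.ext_iff.1 (hp e)).1, p⁻¹ * g, ?_, by group⟩
  simpa using inv_mem hq

end Numberings

/-! ### Young symmetrizers -/

section CharSum

variable {k G : Type*} [Field k] [Group G] {H K : Subgroup G} [Fintype H] [Fintype K]

/-- The sum of a subgroup in the group algebra, weighted by a linear character: the row sum and the
signed column sum of a numbering are of this form. -/
def charSum (H : Subgroup G) [Fintype H] (ε : G →* k) : MonoidAlgebra k G :=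
  ∑ h : H, MonoidAlgebra.single (h : G) (ε h)

theorem single_inv_mul_charSum (ε : G →* k) {h : G} (hh : h ∈ H) :
    MonoidAlgebra.single h⁻¹ 1 * charSum H ε = ε h • charSum H ε := by
  rw [charSum, Finset.mul_sum, Finset.smul_sum]
  refine Fintype.sum_equiv (Equiv.mulLeft (⟨h, hh⟩ : H)⁻¹) _ _ fun x => ?_
  simp [MonoidAlgebra.single_mul_single, ← map_mul]

theorem charSum_mul_single_inv (ε : G →* k) {h : G} (hh : h ∈ H) :
    charSum H ε * MonoidAlgebra.single h⁻¹ 1 = ε h • charSum H ε := by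
  rw [charSum, Finset.sum_mul, Finset.smul_sum]
  refine Fintype.sum_equiv (Equiv.mulRight (⟨h, hh⟩ : H)⁻¹) _ _ fun x => ?_
  simp [MonoidAlgebra.single_mul_single, ← map_mul, mul_comm (ε h)]

theorem charSum_mul_single_mul_charSum_eq_zero {ε η : G →* k} {g h : G} (hH : h ∈ H)
    (hK : g⁻¹ * h * g ∈ K) (hne : ε h ≠ η (g⁻¹ * h * g)) :
    charSum H ε * MonoidAlgebra.single g 1 * charSum K η = 0 := by
  have hconj : MonoidAlgebra.single h⁻¹ (1 : k) * MonoidAlgebra.single g 1 =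
      MonoidAlgebra.single g 1 * MonoidAlgebra.single (g⁻¹ * h * g)⁻¹ 1 := by
    simp only [MonoidAlgebra.single_mul_single]
    group
  have heq : ε h • (charSum H ε * MonoidAlgebra.single g 1 * charSum K η) =
      η (g⁻¹ * h * g) • (charSum H ε * MonoidAlgebra.single g 1 * charSum K η) := by
    rw [← smul_mul_assoc, ← smul_mul_assoc, ← charSum_mul_single_inv ε hH,
      mul_assoc (charSum H ε), hconj, ← mul_assoc, mul_assoc, single_inv_mul_charSum η hK,
      mul_smul_comm]
  rw [← sub_eq_zero, ← sub_smul] at heq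
  exact (smul_eq_zero.1 heq).resolve_left (sub_ne_zero.2 hne)

theorem charSum_mul_charSum (ε η : G →* k) : charSum H ε * charSum K η =
    ∑ x : H × K, MonoidAlgebra.single (x.1 * x.2 : G) (ε x.1 * η x.2) := by
  simp only [charSum, Finset.sum_mul_sum, MonoidAlgebra.single_mul_single,
    Fintype.sum_prod_type]

theorem coeff_charSum_mul_charSum_mul (hHK : Disjoint H K) (ε η : G →* k) (h : H) (l : K) :
    (charSum H ε * charSum K η).coeff (h * l) = ε h * η l := by
  classical
  rw [charSum_mul_charSum, MonoidAlgebra.coeff_sum, Finsupp.finsetSum_apply,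
    Finset.sum_eq_single_of_mem (h, l) (Finset.mem_univ _)]
  · simp
  · intro x _ hx
    rw [MonoidAlgebra.coeff_single, Finsupp.single_apply,
      if_neg fun he => hx (Subgroup.mul_injective_of_disjoint hHK he)]

theorem coeff_charSum_mul_charSum_eq_zero (ε η : G →* k) {g : G}
    (hg : ∀ (h : H) (l : K), (h * l : G) ≠ g) : (charSum H ε * charSum K η).coeff g = 0 := by
  classical
  rw [charSum_mul_charSum, MonoidAlgebra.coeff_sum, Finsupp.finsetSum_apply]
  refine Finset.sum_eq_zero fun x _ => ?_
  rw [MonoidAlgebra.coeff_single, Finsupp.single_apply, if_neg (hg x.1 x.2)]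

theorem coeff_one_charSum_mul_charSum (hHK : Disjoint H K) (ε η : G →* k) :
    (charSum H ε * charSum K η).coeff 1 = 1 := by
  simpa using coeff_charSum_mul_charSum_mul hHK ε η 1 1

theorem norm_coeff_charSum_mul_charSum_le [Finite G] (hHK : Disjoint H K) (ε η : G →* ℂ) (g : G) :
    ‖(charSum H ε * charSum K η).coeff g‖ ≤ 1 := by
  have hnorm : ∀ (χ : G →* ℂ) (x : G), ‖χ x‖ = 1 := fun χ x =>
    (χ.isOfFinOrder (isOfFinOrder_of_finite x)).norm_eq_one
  by_cases hg : ∀ (h : H) (l : K), (h * l : G) ≠ g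
  · simp [coeff_charSum_mul_charSum_eq_zero ε η hg]
  · push Not at hg
    obtain ⟨h, l, rfl⟩ := hg
    rw [coeff_charSum_mul_charSum_mul hHK, norm_mul, hnorm, hnorm, one_mul]

theorem mul_mul_eq_zero_of_forall_single {x z : MonoidAlgebra k G}
    (h : ∀ g, x * MonoidAlgebra.single g 1 * z = 0) (y : MonoidAlgebra k G) : x * y * z = 0 := by
  induction y using MonoidAlgebra.induction_on with
  | of g => exact h g
  | add a b ha hb => rw [mul_add, add_mul, ha, hb, add_zero]
  | smul r a ha => rw [mul_smul_comm, smul_mul_assoc, ha, smul_zero]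

end CharSum

section YoungSymmetrizer

variable {d : ℕ} {lam mu : YoungDiagram}

/-- The group algebra of the symmetric group `S(d)`. -/
abbrev PermAlgebra (d : ℕ) : Type := MonoidAlgebra ℂ (Equiv.Perm (Fin d))

/-- The sign as a complex linear character. -/
def signChar (α : Type*) [Fintype α] [DecidableEq α] : Equiv.Perm α →* ℂ :=
  (Int.castRingHom ℂ : ℤ →* ℂ).comp ((Units.coeHom ℤ).comp Equiv.Perm.sign)

instance {α β : Type*} [Fintype α] [DecidableEq β] (f : α → β) :
    DecidablePred (· ∈ fiberPerms f) :=
  fun g => inferInstanceAs (Decidable (∀ e, f (g e) = f e))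

/-- The sum of the permutations preserving the rows of `t`. -/
def rowSum (t : lam.cells ≃ Fin d) : PermAlgebra d := charSum (fiberPerms (rowOf t)) 1

/-- The signed sum of the permutations preserving the columns of `t`. -/
def colSum (t : lam.cells ≃ Fin d) : PermAlgebra d :=
  charSum (fiberPerms (colOf t)) (signChar (Fin d))

theorem youngSymmetrizer_eq (t : lam.cells ≃ Fin d) :
    youngSymmetrizer t = rowSum t * colSum t := by
  rw [youngSymmetrizer, rowSum, colSum, charSum, charSum]
  congr 1
  · exact (Finset.sum_subtype (rowPerms t) (fun g => by simp [rowPerms, fiberPerms, rowOf]) _)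
  · exact (Finset.sum_subtype (colPerms t) (fun g => by simp [colPerms, fiberPerms, colOf]) _)

theorem youngSymmetrizer_coeff_one (t : lam.cells ≃ Fin d) : (youngSymmetrizer t).coeff 1 = 1 := by
  rw [youngSymmetrizer_eq]
  exact coeff_one_charSum_mul_charSum (disjoint_fiberPerms (rowOf_prod_colOf_injective t)) _ _

theorem norm_youngSymmetrizer_coeff_le (t : lam.cells ≃ Fin d) (g : Equiv.Perm (Fin d)) :
    ‖(youngSymmetrizer t).coeff g‖ ≤ 1 := by
  rw [youngSymmetrizer_eq]
  exact norm_coeff_charSum_mul_charSum_le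
    (disjoint_fiberPerms (rowOf_prod_colOf_injective t)) _ _ g

theorem inv_mul_swap_mul {α : Type*} [DecidableEq α] (g : Equiv.Perm α) (e e' : α) :
    g⁻¹ * Equiv.swap e e' * g = Equiv.swap (g⁻¹ e) (g⁻¹ e') := by
  rw [Equiv.swap_apply_apply, inv_inv]

theorem signChar_swap {α : Type*} [Fintype α] [DecidableEq α] {e e' : α} (h : e ≠ e') :
    signChar α (Equiv.swap e e') = -1 := by
  simp [signChar, Equiv.Perm.sign_swap h]

theorem rowSum_mul_single_mul_colSum_eq_zero (t : lam.cells ≃ Fin d) (s : mu.cells ≃ Fin d)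
    (g : Equiv.Perm (Fin d))
    (h : ¬ Function.Injective fun e => (rowOf t e, colOf (s.trans g) e)) :
    rowSum t * MonoidAlgebra.single g 1 * colSum s = 0 := by
  obtain ⟨e, e', heq, hne⟩ := Function.not_injective_iff.1 h
  obtain ⟨hrow, hcol⟩ := Prod.ext_iff.1 heq
  refine charSum_mul_single_mul_charSum_eq_zero (swap_mem_fiberPerms hrow) ?_ ?_
  · rw [inv_mul_swap_mul]
    exact swap_mem_fiberPerms hcol
  · rw [inv_mul_swap_mul, signChar_swap (g⁻¹.injective.ne hne), MonoidHom.one_apply]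
    norm_num

theorem colSum_mul_single_mul_rowSum_eq_zero (t : lam.cells ≃ Fin d) (s : mu.cells ≃ Fin d)
    (g : Equiv.Perm (Fin d))
    (h : ¬ Function.Injective fun e => (rowOf (s.trans g) e, colOf t e)) :
    colSum t * MonoidAlgebra.single g 1 * rowSum s = 0 := by
  obtain ⟨e, e', heq, hne⟩ := Function.not_injective_iff.1 h
  obtain ⟨hrow, hcol⟩ := Prod.ext_iff.1 heq
  refine charSum_mul_single_mul_charSum_eq_zero (swap_mem_fiberPerms hcol) ?_ ?_
  · rw [inv_mul_swap_mul]
    exact swap_mem_fiberPerms hrow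
  · rw [signChar_swap hne, MonoidHom.one_apply]
    norm_num

/-- If neither `rowSum t * g * colSum s` nor `colSum t * h * rowSum s` vanishes for some `g`, `h`,
then each of the two shapes dominates the other. -/
theorem youngSymmetrizer_mul_mul_eq_zero (t : lam.cells ≃ Fin d) (s : mu.cells ≃ Fin d)
    (hne : lam ≠ mu) (x : PermAlgebra d) : youngSymmetrizer t * x * youngSymmetrizer s = 0 := by
  rw [youngSymmetrizer_eq, youngSymmetrizer_eq]
  by_cases hrc : ∀ g, rowSum t * MonoidAlgebra.single g 1 * colSum s = 0
  · simpa only [mul_assoc] using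
      mul_mul_eq_zero_of_forall_single hrc (colSum t * x * rowSum s)
  by_cases hcr : ∀ g, colSum t * MonoidAlgebra.single g 1 * rowSum s = 0
  · calc rowSum t * colSum t * x * (rowSum s * colSum s)
        = rowSum t * (colSum t * x * rowSum s) * colSum s := by simp only [mul_assoc]
      _ = 0 := by rw [mul_mul_eq_zero_of_forall_single hcr, mul_zero, zero_mul]
  push Not at hrc hcr
  obtain ⟨g, hg⟩ := hrc
  obtain ⟨h, hh⟩ := hcr
  refine absurd (eq_of_firstRows_eq fun k => le_antisymm ?_ ?_) hne
  · exact firstRows_le_firstRows t (s.trans g)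
      (not_not.1 fun hinj => hg (rowSum_mul_single_mul_colSum_eq_zero t s g hinj)) k
  · exact firstRows_le_firstRows (s.trans h) t
      (not_not.1 fun hinj => hh (colSum_mul_single_mul_rowSum_eq_zero t s h hinj)) k

theorem exists_rowSum_mul_mul_colSum_eq_smul (t : lam.cells ≃ Fin d) (x : PermAlgebra d) :
    ∃ c : ℂ, rowSum t * x * colSum t = c • youngSymmetrizer t := by
  induction x using MonoidAlgebra.induction_on with
  | of g =>
    by_cases hinj : Function.Injective fun e => (rowOf t e, colOf (t.trans g) e)
    · obtain ⟨p, hp, q, hq, rfl⟩ := exists_eq_mul_of_rowOf_prod_colOf_injective t g hinj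
      have hrow : rowSum t * MonoidAlgebra.single p 1 = rowSum t := by
        simpa [rowSum] using charSum_mul_single_inv (k := ℂ) 1 (inv_mem hp)
      have hcol := single_inv_mul_charSum (signChar (Fin d)) (inv_mem hq)
      rw [inv_inv] at hcol
      refine ⟨signChar _ q⁻¹, ?_⟩
      rw [map_mul, ← mul_assoc, MonoidAlgebra.of_apply, MonoidAlgebra.of_apply, hrow, mul_assoc,
        colSum, hcol, mul_smul_comm, youngSymmetrizer_eq, colSum]
    · exact ⟨0, by
        rw [MonoidAlgebra.of_apply, rowSum_mul_single_mul_colSum_eq_zero t t g hinj, zero_smul]⟩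
  | add a b ha hb =>
    obtain ⟨r, ha⟩ := ha
    obtain ⟨s, hb⟩ := hb
    exact ⟨r + s, by rw [mul_add, add_mul, ha, hb, add_smul]⟩
  | smul r a ha =>
    obtain ⟨s, ha⟩ := ha
    exact ⟨r * s, by rw [mul_smul_comm, smul_mul_assoc, ha, mul_smul]⟩

theorem exists_youngSymmetrizer_mul_mul_eq_smul (t : lam.cells ≃ Fin d) (x : PermAlgebra d) :
    ∃ c : ℂ, youngSymmetrizer t * x * youngSymmetrizer t = c • youngSymmetrizer t := by
  obtain ⟨c, hc⟩ := exists_rowSum_mul_mul_colSum_eq_smul t (colSum t * x * rowSum t)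
  exact ⟨c, by simpa only [youngSymmetrizer_eq, mul_assoc] using hc⟩

end YoungSymmetrizer

/-! ### Primitive idempotents of a group algebra -/

section GroupAlgebra

theorem sum_smul_mul_eq_smul {k R ι : Type*} [Fintype ι] [Field k] [Ring R]
    [Algebra k R] {c : ι → R} (hc : OrthogonalIdempotents c) (a : ι → k) (i : ι) :
    (∑ j, a j • c j) * c i = a i • c i := by
  rw [Finset.sum_mul, Finset.sum_eq_single_of_mem i (Finset.mem_univ i)]
  · rw [smul_mul_assoc, (hc.idem i).eq]
  · intro j _ hj
    rw [smul_mul_assoc, hc.ortho hj, smul_zero]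

theorem linearIndependent_of_orthogonalIdempotents {k R ι : Type*} [Finite ι] [Field k] [Ring R]
    [Algebra k R] {c : ι → R} (hc : OrthogonalIdempotents c) (hne : ∀ i, c i ≠ 0) :
    LinearIndependent k c := by
  have := Fintype.ofFinite ι
  rw [Fintype.linearIndependent_iff]
  intro a ha i
  have h := sum_smul_mul_eq_smul hc a i
  rw [ha, zero_mul] at h
  exact (smul_eq_zero.1 h.symm).resolve_right (hne i)

theorem trace_eq_sum_coeff {k G : Type*} [Field k] [Fintype G]
    (f : MonoidAlgebra k G →ₗ[k] MonoidAlgebra k G) :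
    LinearMap.trace k _ f = ∑ g, (f (MonoidAlgebra.single g 1)).coeff g := by
  classical
  rw [LinearMap.trace_eq_matrix_trace k (MonoidAlgebra.basis G k), Matrix.trace]
  refine Finset.sum_congr rfl fun g _ => ?_
  rw [Matrix.diag_apply, LinearMap.toMatrix_apply]
  rfl

variable {k G : Type*} [Field k] [Group G]

theorem coeff_mul_comm_one (x y : MonoidAlgebra k G) : (x * y).coeff 1 = (y * x).coeff 1 := by
  induction x using MonoidAlgebra.induction_on with
  | of g => simp
  | add a b ha hb => simp [add_mul, mul_add, ha, hb]
  | smul r a ha => simp [ha]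

theorem mem_center_of_forall_single {x : MonoidAlgebra k G}
    (hx : ∀ g, MonoidAlgebra.single g 1 * x = x * MonoidAlgebra.single g 1) :
    x ∈ Subalgebra.center k (MonoidAlgebra k G) := by
  refine Subalgebra.mem_center_iff.2 fun y => ?_
  induction y using MonoidAlgebra.induction_on with
  | of g => exact hx g
  | add a b ha hb => rw [add_mul, mul_add, ha, hb]
  | smul r a ha => rw [smul_mul_assoc, mul_smul_comm, ha]

theorem coeff_eq_of_isConj {x : MonoidAlgebra k G}
    (hx : x ∈ Subalgebra.center k (MonoidAlgebra k G)) {g h : G} (hgh : IsConj g h) :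
    x.coeff g = x.coeff h := by
  obtain ⟨c, rfl⟩ := isConj_iff.1 hgh
  have := congrArg (fun y => y.coeff (c * g))
    (Subalgebra.mem_center_iff.1 hx (MonoidAlgebra.single c 1))
  simpa [mul_assoc] using this

theorem finrank_center_le_card_conjClasses [Finite G] :
    Module.finrank k (Subalgebra.center k (MonoidAlgebra k G)) ≤ Nat.card (ConjClasses G) := by
  have := Fintype.ofFinite (ConjClasses G)
  rw [Nat.card_eq_fintype_card, ← Module.finrank_fintype_fun_eq_card k]
  let F : Subalgebra.center k (MonoidAlgebra k G) →ₗ[k] (ConjClasses G → k) :=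
    { toFun := fun x c => x.1.coeff c.out
      map_add' := fun x y => by ext; simp
      map_smul' := fun r x => by ext; simp }
  refine LinearMap.finrank_le_finrank_of_injective (f := F) fun x y hxy => ?_
  refine Subtype.ext (MonoidAlgebra.coeff_injective (Finsupp.ext fun g => ?_))
  have hg : IsConj g (ConjClasses.mk g).out :=
    ConjClasses.mk_eq_mk_iff_isConj.1 (Quotient.out_eq (ConjClasses.mk g)).symm
  rw [coeff_eq_of_isConj x.2 hg, coeff_eq_of_isConj y.2 hg]
  exact congrFun hxy (ConjClasses.mk g)

theorem coeff_one_eq_zero_of_mul_self_eq_zero [CharZero k] [Finite G] {x : MonoidAlgebra k G}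
    (hx : x * x = 0) : x.coeff 1 = 0 := by
  have := Fintype.ofFinite G
  have hnil : IsNilpotent (LinearMap.mulRight k x) := by
    refine ⟨2, LinearMap.ext fun y => ?_⟩
    rw [pow_two, Module.End.mul_apply, LinearMap.mulRight_apply, LinearMap.mulRight_apply,
      mul_assoc, hx, mul_zero, LinearMap.zero_apply]
  have htrace := (LinearMap.isNilpotent_trace_of_isNilpotent hnil).eq_zero
  rw [trace_eq_sum_coeff] at htrace
  simpa using htrace

variable [Fintype G]

theorem eq_sum_coeff_smul_single (x : MonoidAlgebra k G) :
    x = ∑ g, x.coeff g • MonoidAlgebra.single g (1 : k) := by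
  classical
  refine MonoidAlgebra.coeff_injective (Finsupp.ext fun h => ?_)
  rw [MonoidAlgebra.coeff_sum, Finsupp.finsetSum_apply]
  simp [Finsupp.single_apply]

/-- The representation of a group on a left ideal of its group algebra, by left multiplication. -/
def leftIdealRep (I : Submodule (MonoidAlgebra k G) (MonoidAlgebra k G)) : Representation k G I :=
  (Algebra.lsmul k k I).toMonoidHom.comp (MonoidAlgebra.of k G)

theorem character_leftIdealRep {I : Submodule (MonoidAlgebra k G) (MonoidAlgebra k G)}
    {e : MonoidAlgebra k G} (he : IsIdempotentElem e) (hI : ∀ x, x ∈ I ↔ x * e = x) (g : G) :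
    (leftIdealRep I).character g = ∑ h, e.coeff (h⁻¹ * g⁻¹ * h) := by
  let f : MonoidAlgebra k G →ₗ[k] MonoidAlgebra k G :=
    LinearMap.mulLeft k (MonoidAlgebra.single g 1) ∘ₗ LinearMap.mulRight k e
  have hf : ∀ x, f x ∈ I.restrictScalars k := fun x => by
    rw [Submodule.restrictScalars_mem, hI]
    simp only [f, LinearMap.comp_apply, LinearMap.mulLeft_apply, LinearMap.mulRight_apply,
      mul_assoc, he.eq]
  let r : I →ₗ[k] I := by
    exact f.restrict fun x (_ : x ∈ I.restrictScalars k) => hf x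
  have hr : leftIdealRep I g = r := LinearMap.ext fun x => Subtype.ext <| by
    change MonoidAlgebra.single g 1 * x.1 = MonoidAlgebra.single g 1 * (x.1 * e)
    rw [(hI _).1 x.2]
  rw [Representation.character, hr]
  refine (LinearMap.trace_restrict_eq_of_forall_mem (I.restrictScalars k) f hf).trans ?_
  rw [trace_eq_sum_coeff]
  exact Finset.sum_congr rfl fun h _ => by simp [f, ← mul_assoc]

/-- The sum of all conjugates of `e` by group elements. -/
def conjSum (e : MonoidAlgebra k G) : MonoidAlgebra k G :=
  ∑ h : G, MonoidAlgebra.single h 1 * e * MonoidAlgebra.single h⁻¹ 1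

theorem coeff_conjSum (e : MonoidAlgebra k G) (g : G) :
    (conjSum e).coeff g = ∑ h, e.coeff (h⁻¹ * g * h) := by
  rw [conjSum, MonoidAlgebra.coeff_sum, Finsupp.finsetSum_apply]
  exact Finset.sum_congr rfl fun h _ => by simp [mul_assoc]

theorem conjSum_mem_center (e : MonoidAlgebra k G) :
    conjSum e ∈ Subalgebra.center k (MonoidAlgebra k G) := by
  refine mem_center_of_forall_single fun g => ?_
  rw [conjSum, Finset.mul_sum, Finset.sum_mul]
  refine Fintype.sum_equiv (Equiv.mulLeft g) _ _ fun h => ?_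
  simp only [Equiv.coe_mulLeft, mul_inv_rev, ← mul_assoc, MonoidAlgebra.single_mul_single, mul_one]
  rw [mul_assoc _ _ (MonoidAlgebra.single g 1), MonoidAlgebra.single_mul_single]
  simp

theorem mul_conjSum {x : MonoidAlgebra k G} (hx : x ∈ Subalgebra.center k (MonoidAlgebra k G))
    (e : MonoidAlgebra k G) : x * conjSum e = conjSum (x * e) := by
  rw [conjSum, conjSum, Finset.mul_sum]
  refine Finset.sum_congr rfl fun h _ => ?_
  simp only [← mul_assoc]
  rw [Subalgebra.mem_center_iff.1 hx]

/-- A nonzero idempotent `e` with `e * k[G] * e = k • e`; in the semisimple case it generates an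
absolutely irreducible left ideal. -/
structure IsSplitPrimitive (e : MonoidAlgebra k G) : Prop where
  isIdempotentElem : IsIdempotentElem e
  ne_zero : e ≠ 0
  exists_mul_mul_eq_smul : ∀ x, ∃ c : k, e * x * e = c • e

/-- The central idempotent `(dim V / |G|) ∑ g, χ_V(g⁻¹) g` of the module `V = k[G] e`, see
`coeff_conjSum` and `character_leftIdealRep`. -/
def centralIdem (e : MonoidAlgebra k G) : MonoidAlgebra k G := e.coeff 1 • conjSum e

theorem centralIdem_mem_center (e : MonoidAlgebra k G) :
    centralIdem e ∈ Subalgebra.center k (MonoidAlgebra k G) :=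
  Subalgebra.smul_mem _ (conjSum_mem_center e) _

theorem IsSplitPrimitive.centralIdem_mul_self {e : MonoidAlgebra k G} (he : IsSplitPrimitive e) :
    centralIdem e * e = e := by
  have hconj : ∀ h : G, e.coeff 1 •
      (MonoidAlgebra.single h 1 * e * MonoidAlgebra.single h⁻¹ 1 * e) =
        (e.coeff h • MonoidAlgebra.single h 1) * e := fun h => by
    obtain ⟨c, hc⟩ := he.exists_mul_mul_eq_smul (MonoidAlgebra.single h⁻¹ 1)
    have hcoeff : c * e.coeff 1 = e.coeff h := by
      calc c * e.coeff 1 = (e * MonoidAlgebra.single h⁻¹ 1 * e).coeff 1 := by rw [hc]; simp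
        _ = e.coeff h := by
          rw [coeff_mul_comm_one, ← mul_assoc, he.isIdempotentElem.eq]
          simp
    rw [mul_assoc, mul_assoc, ← mul_assoc e, hc, mul_smul_comm, smul_smul, mul_comm, hcoeff,
      smul_mul_assoc]
  rw [centralIdem, smul_mul_assoc, conjSum, Finset.sum_mul, Finset.smul_sum,
    Finset.sum_congr rfl fun h _ => hconj h, ← Finset.sum_mul, ← eq_sum_coeff_smul_single,
    he.isIdempotentElem.eq]

theorem IsSplitPrimitive.centralIdem_ne_zero {e : MonoidAlgebra k G} (he : IsSplitPrimitive e) :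
    centralIdem e ≠ 0 := fun h =>
  he.ne_zero (by rw [← he.centralIdem_mul_self, h, zero_mul])

theorem centralIdem_mul_centralIdem (e f : MonoidAlgebra k G) :
    centralIdem e * centralIdem f = f.coeff 1 • conjSum (centralIdem e * f) := by
  rw [← mul_conjSum (centralIdem_mem_center e), ← mul_smul_comm, ← centralIdem]

theorem centralIdem_mul_eq_zero {e f : MonoidAlgebra k G} (h : ∀ x, e * x * f = 0) :
    centralIdem e * f = 0 := by
  rw [centralIdem, smul_mul_assoc, conjSum, Finset.sum_mul, Finset.sum_eq_zero, smul_zero]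
  intro g _
  rw [mul_assoc, mul_assoc, ← mul_assoc e, h, mul_zero]

variable {ι : Type*} {e : ι → MonoidAlgebra k G}

theorem orthogonalIdempotents_centralIdem (he : ∀ i, IsSplitPrimitive (e i))
    (horth : ∀ i j, i ≠ j → ∀ x, e i * x * e j = 0) :
    OrthogonalIdempotents fun i => centralIdem (e i) where
  idem i := by
    rw [IsIdempotentElem, centralIdem_mul_centralIdem, (he i).centralIdem_mul_self, centralIdem]
  ortho i j hij := by
    simp only [centralIdem_mul_centralIdem, centralIdem_mul_eq_zero (horth i j hij), conjSum,
      mul_zero, zero_mul, Finset.sum_const_zero, smul_zero]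

/-- As many orthogonal central idempotents as there are conjugacy classes span the centre. -/
theorem exists_eq_sum_smul_centralIdem (he : ∀ i, IsSplitPrimitive (e i))
    (horth : ∀ i j, i ≠ j → ∀ x, e i * x * e j = 0)
    [Fintype ι] (hcard : Nat.card (ConjClasses G) ≤ Fintype.card ι) {x : MonoidAlgebra k G}
    (hx : x ∈ Subalgebra.center k (MonoidAlgebra k G)) :
    ∃ a : ι → k, x = ∑ i, a i • centralIdem (e i) := by
  let c : ι → Subalgebra.center k (MonoidAlgebra k G) :=
    fun i => ⟨centralIdem (e i), centralIdem_mem_center _⟩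
  have hc : LinearIndependent k c :=
    LinearIndependent.of_comp (Subalgebra.val _).toLinearMap <|
      linearIndependent_of_orthogonalIdempotents (orthogonalIdempotents_centralIdem he horth)
        fun i => (he i).centralIdem_ne_zero
  have hspan := hc.span_eq_top_of_card_eq_finrank' <|
    le_antisymm hc.fintype_card_le_finrank (finrank_center_le_card_conjClasses.trans hcard)
  have hmem : (⟨x, hx⟩ : Subalgebra.center k (MonoidAlgebra k G)) ∈
      Submodule.span k (Set.range c) := hspan ▸ Submodule.mem_top
  obtain ⟨a, ha⟩ := (Submodule.mem_span_range_iff_exists_fun k).1 hmem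
  exact ⟨a, by simpa [c] using (congrArg Subtype.val ha).symm⟩

theorem completeOrthogonalIdempotents_centralIdem (he : ∀ i, IsSplitPrimitive (e i))
    (horth : ∀ i j, i ≠ j → ∀ x, e i * x * e j = 0)
    [Fintype ι] (hcard : Nat.card (ConjClasses G) ≤ Fintype.card ι) :
    CompleteOrthogonalIdempotents fun i => centralIdem (e i) where
  toOrthogonalIdempotents := orthogonalIdempotents_centralIdem he horth
  complete := by
    obtain ⟨a, ha⟩ := exists_eq_sum_smul_centralIdem he horth hcard (one_mem _)
    have hone : ∀ i, a i = 1 := fun i => by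
      have h := sum_smul_mul_eq_smul (orthogonalIdempotents_centralIdem he horth) a i
      rw [← ha, one_mul] at h
      exact (smul_left_injective k (he i).centralIdem_ne_zero ((one_smul k _).trans h)).symm
    simpa only [hone, one_smul] using ha.symm

end GroupAlgebra

/-! ### The idempotents of the shapes with `d` cells -/

/-- Young diagrams with `d` cells. -/
abbrev Shape (d : ℕ) : Type := {lam : YoungDiagram // lam.card = d}

theorem numRows_le_card (lam : YoungDiagram) : numRows lam ≤ lam.card := by
  rw [numRows, lam.colLen_eq_card]
  exact Finset.card_le_card (Finset.filter_subset _ _)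

instance (d : ℕ) : Finite (Shape d) :=
  ((finite_diagrams d d).subset fun lam (h : lam.card = d) =>
    ⟨h, h ▸ numRows_le_card lam⟩ : {lam : YoungDiagram | lam.card = d}.Finite).to_subtype

instance (d : ℕ) : Fintype (Shape d) := Fintype.ofFinite _

section Shape

variable {d : ℕ}

/-- The Young symmetrizer of a shape, for the chosen numbering. -/
def youngSym (l : Shape d) : PermAlgebra d :=
  youngSymmetrizer ((numbering l.1).trans (finCongr l.2))

theorem youngSym_mk (lam : YoungDiagram) :
    youngSym (⟨lam, rfl⟩ : Shape lam.card) = youngSymmetrizer (numbering lam) := rfl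

theorem youngSym_coeff_one (l : Shape d) : (youngSym l).coeff 1 = 1 := youngSymmetrizer_coeff_one _

theorem exists_youngSym_mul_mul_youngSym_eq_smul (l : Shape d) (x : PermAlgebra d) :
    ∃ c : ℂ, youngSym l * x * youngSym l = c • youngSym l :=
  exists_youngSymmetrizer_mul_mul_eq_smul _ x

/-- The scalar `κ` with `c * c = κ • c` for the Young symmetrizer `c`. -/
def youngScalar (l : Shape d) : ℂ := (youngSym l * youngSym l).coeff 1

theorem youngSym_mul_youngSym (l : Shape d) :
    youngSym l * youngSym l = youngScalar l • youngSym l := by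
  obtain ⟨c, hc⟩ := exists_youngSym_mul_mul_youngSym_eq_smul l 1
  rw [mul_one] at hc
  rw [youngScalar, hc, MonoidAlgebra.coeff_smul_apply, youngSym_coeff_one, smul_eq_mul, mul_one]

theorem youngScalar_ne_zero (l : Shape d) : youngScalar l ≠ 0 := fun h =>
  one_ne_zero <| (youngSym_coeff_one l).symm.trans <|
    coeff_one_eq_zero_of_mul_self_eq_zero (by rw [youngSym_mul_youngSym, h, zero_smul])

/-- The primitive idempotent proportional to the Young symmetrizer. -/
def youngIdem (l : Shape d) : PermAlgebra d := (youngScalar l)⁻¹ • youngSym l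

theorem youngSym_eq_smul_youngIdem (l : Shape d) : youngSym l = youngScalar l • youngIdem l := by
  rw [youngIdem, smul_smul, mul_inv_cancel₀ (youngScalar_ne_zero l), one_smul]

theorem youngIdem_coeff_one (l : Shape d) : (youngIdem l).coeff 1 = (youngScalar l)⁻¹ := by
  simp [youngIdem, youngSym_coeff_one]

theorem isSplitPrimitive_youngIdem (l : Shape d) : IsSplitPrimitive (youngIdem l) where
  isIdempotentElem := by
    rw [IsIdempotentElem, youngIdem, smul_mul_smul_comm, youngSym_mul_youngSym, smul_smul,
      mul_assoc, inv_mul_cancel₀ (youngScalar_ne_zero l), mul_one]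
  ne_zero h := by
    have hcoeff := youngIdem_coeff_one l
    rw [h] at hcoeff
    exact inv_ne_zero (youngScalar_ne_zero l) hcoeff.symm
  exists_mul_mul_eq_smul x := by
    obtain ⟨c, hc⟩ := exists_youngSym_mul_mul_youngSym_eq_smul l x
    refine ⟨(youngScalar l)⁻¹ * c, ?_⟩
    rw [youngIdem, smul_mul_assoc, smul_mul_assoc, mul_smul_comm, hc, smul_smul _ c, smul_comm]

theorem youngIdem_mul_mul_youngIdem_of_ne (l m : Shape d) (h : l ≠ m) (x : PermAlgebra d) :
    youngIdem l * x * youngIdem m = 0 := by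
  have hsym : youngSym l * x * youngSym m = 0 :=
    youngSymmetrizer_mul_mul_eq_zero _ _ (fun e => h (Subtype.ext e)) x
  rw [youngIdem, youngIdem, smul_mul_assoc, smul_mul_assoc, mul_smul_comm, hsym, smul_zero,
    smul_zero]

theorem mem_V_iff (lam : YoungDiagram) (x : PermAlgebra lam.card) :
    x ∈ V lam ↔ x * youngIdem (⟨lam, rfl⟩ : Shape lam.card) = x := by
  rw [V, Submodule.mem_span_singleton, ← youngSym_mk]
  constructor
  · rintro ⟨a, rfl⟩
    rw [smul_eq_mul, youngSym_eq_smul_youngIdem, mul_smul_comm, smul_mul_assoc, mul_assoc,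
      (isSplitPrimitive_youngIdem _).isIdempotentElem.eq]
  · intro h
    refine ⟨(youngScalar (⟨lam, rfl⟩ : Shape lam.card))⁻¹ • x, ?_⟩
    rw [smul_eq_mul, smul_mul_assoc, ← mul_smul_comm, ← youngIdem, h]

theorem character_Vrep (lam : YoungDiagram) (g : Equiv.Perm (Fin lam.card)) :
    (Vrep lam).character g = (conjSum (youngIdem (⟨lam, rfl⟩ : Shape lam.card))).coeff g⁻¹ := by
  rw [coeff_conjSum]
  exact character_leftIdealRep (isSplitPrimitive_youngIdem _).isIdempotentElem (mem_V_iff lam) g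

theorem youngIdem_coeff_one_eq (l : Shape d) : (youngIdem l).coeff 1 = dimV l.1 / d.factorial := by
  obtain ⟨lam, rfl⟩ := l
  have hchar : (dimV lam : ℂ) = (Vrep lam).character 1 := by rw [Representation.char_one, dimV]
  rw [hchar, character_Vrep, coeff_conjSum, eq_div_iff (by exact_mod_cast Nat.factorial_ne_zero _)]
  simp [Fintype.card_perm, mul_comm]

theorem dimV_pos (lam : YoungDiagram) : 0 < dimV lam := by
  refine Nat.pos_of_ne_zero fun h =>
    inv_ne_zero (youngScalar_ne_zero (⟨lam, rfl⟩ : Shape lam.card)) ?_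
  rw [← youngIdem_coeff_one, youngIdem_coeff_one_eq, h, Nat.cast_zero, zero_div]

theorem norm_youngIdem_coeff_le (l : Shape d) (g : Equiv.Perm (Fin d)) :
    ‖(youngIdem l).coeff g‖ ≤ dimV l.1 / d.factorial := by
  have hnorm : (dimV l.1 / d.factorial : ℝ) = ‖(youngIdem l).coeff 1‖ := by
    simp [youngIdem_coeff_one_eq]
  rw [hnorm, youngIdem_coeff_one, youngIdem, MonoidAlgebra.coeff_smul_apply, norm_smul]
  exact mul_le_of_le_one_right (norm_nonneg _) (norm_youngSymmetrizer_coeff_le _ _)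

theorem norm_character_Vrep_le (lam : YoungDiagram) (g : Equiv.Perm (Fin lam.card)) :
    ‖(Vrep lam).character g‖ ≤ dimV lam := by
  rw [character_Vrep, coeff_conjSum]
  refine (norm_sum_le _ _).trans <|
    (Finset.sum_le_card_nsmul _ _ _ fun h _ => norm_youngIdem_coeff_le _ _).trans ?_
  rw [Finset.card_univ, Fintype.card_perm, Fintype.card_fin, nsmul_eq_mul,
    mul_div_cancel₀ _ (by exact_mod_cast Nat.factorial_ne_zero _)]

/-- The central idempotent of a shape. -/
def youngCent (l : Shape d) : PermAlgebra d := centralIdem (youngIdem l)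

theorem youngCent_eq (l : Shape d) :
    youngCent l = (dimV l.1 / d.factorial : ℂ) • conjSum (youngIdem l) := by
  rw [youngCent, centralIdem, youngIdem_coeff_one_eq]

theorem card_cellsOfRowLens (w : List ℕ) : (YoungDiagram.cellsOfRowLens w).card = w.sum := by
  induction w with
  | nil => rfl
  | cons a w ih =>
    rw [YoungDiagram.cellsOfRowLens, Finset.card_union_of_disjoint, Finset.card_map, ih]
    · simp
    · rw [Finset.disjoint_left]
      rintro ⟨i, j⟩ htop hshift
      simp only [Finset.mem_product, Finset.mem_singleton] at htop
      obtain ⟨⟨i', j'⟩, -, h⟩ := Finset.mem_map.1 hshift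
      have : i' + 1 = i := congrArg Prod.fst h
      omega

theorem card_partition_le_card_shape (d : ℕ) :
    Fintype.card d.Partition ≤ Fintype.card (Shape d) := by
  have hs : ∀ p : d.Partition, (p.parts.sort (· ≥ ·)).SortedGE := fun p =>
    (Multiset.pairwise_sort p.parts (· ≥ ·)).sortedGE
  have hpos : ∀ p : d.Partition, ∀ x ∈ p.parts.sort (· ≥ ·), 0 < x :=
    fun p x hx => p.parts_pos (by simpa using hx)
  refine Fintype.card_le_of_injective
    (fun p => (⟨YoungDiagram.ofRowLens _ (hs p), ?_⟩ : Shape d)) fun p q h => ?_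
  · refine (card_cellsOfRowLens _).trans ?_
    rw [← Multiset.sum_coe, Multiset.sort_eq, p.parts_sum]
  · have hlens := congrArg (fun l : Shape d => l.1.rowLens) h
    simp only [YoungDiagram.rowLens_ofRowLens_eq_self (hpos _)] at hlens
    refine Nat.Partition.ext ?_
    rw [← Multiset.sort_eq p.parts (· ≥ ·), hlens, Multiset.sort_eq]

theorem card_conjClasses_perm_le (α : Type*) [Fintype α] :
    Nat.card (ConjClasses (Equiv.Perm α)) ≤ Fintype.card (Fintype.card α).Partition := by
  classical
  rw [← Nat.card_eq_fintype_card]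
  refine Nat.card_le_card_of_injective
    (Quotient.lift Equiv.Perm.partition fun _ _ h => Equiv.Perm.partition_eq_of_isConj.1 h) ?_
  rintro ⟨g⟩ ⟨h⟩ hgh
  exact Quotient.sound (Equiv.Perm.partition_eq_of_isConj.2 hgh)

theorem card_conjClasses_perm_le_card_shape (d : ℕ) :
    Nat.card (ConjClasses (Equiv.Perm (Fin d))) ≤ Fintype.card (Shape d) := by
  refine (card_conjClasses_perm_le (Fin d)).trans ?_
  rw [Fintype.card_fin]
  exact card_partition_le_card_shape d

theorem completeOrthogonalIdempotents_youngCent (d : ℕ) :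
    CompleteOrthogonalIdempotents (youngCent : Shape d → PermAlgebra d) :=
  completeOrthogonalIdempotents_centralIdem isSplitPrimitive_youngIdem
    youngIdem_mul_mul_youngIdem_of_ne (card_conjClasses_perm_le_card_shape d)

theorem eq_sum_coeff_smul_youngCent {x : PermAlgebra d}
    (hx : x ∈ Subalgebra.center ℂ (PermAlgebra d)) :
    x = ∑ l : Shape d, (youngScalar l * (x * youngIdem l).coeff 1) • youngCent l := by
  obtain ⟨a, ha⟩ : ∃ a : Shape d → ℂ, x = ∑ l, a l • youngCent l :=
    exists_eq_sum_smul_centralIdem isSplitPrimitive_youngIdem youngIdem_mul_mul_youngIdem_of_ne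
      (card_conjClasses_perm_le_card_shape d) hx
  have hidem : ∀ l, x * youngIdem l = a l • youngIdem l := fun l => by
    have hcent : youngCent l * youngIdem l = youngIdem l :=
      (isSplitPrimitive_youngIdem l).centralIdem_mul_self
    rw [← hcent, ← mul_assoc, ha, ← smul_mul_assoc,
      sum_smul_mul_eq_smul (completeOrthogonalIdempotents_youngCent d).toOrthogonalIdempotents a l]
  refine ha.trans (Finset.sum_congr rfl fun l _ => congrArg (· • youngCent l) ?_)
  rw [hidem, MonoidAlgebra.coeff_smul_apply, youngIdem_coeff_one, smul_eq_mul, mul_left_comm,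
    mul_inv_cancel₀ (youngScalar_ne_zero l), mul_one]

end Shape

/-! ### Triangularization and the eigenvalues of a matrix -/

section Triangular

variable {K : Type*} [Field K]

theorem exists_invariant_ker [IsAlgClosed K] {E : Type*} [AddCommGroup E] [Module K E]
    [FiniteDimensional K E] [Nontrivial E] (f : E →ₗ[K] E) :
    ∃ φ : Module.Dual K E, φ ≠ 0 ∧ ∀ x ∈ LinearMap.ker φ, f x ∈ LinearMap.ker φ := by
  obtain ⟨μ, hμ⟩ := Module.End.exists_eigenvalue f
  obtain ⟨v, hv⟩ := hμ.exists_hasEigenvector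
  have hrange : LinearMap.range (f - μ • LinearMap.id) < ⊤ := by
    refine lt_top_iff_ne_top.2 fun h => hv.2 ?_
    refine LinearMap.injective_iff_surjective.2 (LinearMap.range_eq_top.1 h) ?_
    simp [hv.apply_eq_smul]
  obtain ⟨φ, hφ, hle⟩ := Submodule.exists_le_ker_of_lt_top _ hrange
  refine ⟨φ, hφ, fun x hx => ?_⟩
  have hfx := hle ⟨x, rfl⟩
  simp only [LinearMap.sub_apply, LinearMap.smul_apply, LinearMap.id_apply] at hfx
  simpa using add_mem hfx (Submodule.smul_mem _ μ hx)

theorem repr_mkFinCons_ker {n : ℕ} {E : Type*} [AddCommGroup E] [Module K E]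
    {φ : Module.Dual K E} (b : Module.Basis (Fin n) K (LinearMap.ker φ)) {y : E} (hli hsp)
    (x : LinearMap.ker φ) :
    ⇑((Module.Basis.mkFinCons y b hli hsp).repr x) = Fin.cons 0 (b.repr x) := by
  set B := Module.Basis.mkFinCons y b hli hsp
  have hx : (x : E) = ∑ i, b.repr x i • B i.succ := by
    conv_lhs => rw [← b.sum_repr x, Submodule.coe_sum]
    exact Finset.sum_congr rfl fun i _ => by simp [B]
  ext i
  rw [hx]
  cases i using Fin.cases <;> simp [Finsupp.single_apply]

theorem exists_triangular_basis [IsAlgClosed K] (n : ℕ) {E : Type*} [AddCommGroup E] [Module K E]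
    [FiniteDimensional K E] (hn : Module.finrank K E = n) (f : E →ₗ[K] E) :
    ∃ b : Module.Basis (Fin n) K E, ∀ i j, i < j → b.repr (f (b j)) i = 0 := by
  induction n generalizing E with
  | zero => exact ⟨Module.finBasisOfFinrankEq K E hn, fun i => i.elim0⟩
  | succ n ih =>
    have : Nontrivial E := Module.nontrivial_of_finrank_pos (R := K) (by omega)
    obtain ⟨φ, hφ, hinv⟩ := exists_invariant_ker f
    have hdim := Module.Dual.finrank_ker_add_one_of_ne_zero (f := φ) hφ
    obtain ⟨b, hb⟩ := ih (E := LinearMap.ker φ) (by omega) (f.restrict hinv)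
    obtain ⟨y, hy⟩ : ∃ y, φ y ≠ 0 := by
      by_contra! h
      exact hφ (LinearMap.ext h)
    have hli : ∀ (c : K) (x : E), x ∈ LinearMap.ker φ → c • y + x = 0 → c = 0 := fun c x hx h => by
      have hφx := congrArg φ h
      rw [LinearMap.mem_ker] at hx
      simpa [hx, hy] using hφx
    have hsp : ∀ z : E, ∃ c : K, z + c • y ∈ LinearMap.ker φ := fun z =>
      ⟨-(φ z / φ y), by simp [hy]⟩
    let B := Module.Basis.mkFinCons y b hli hsp
    refine ⟨B, fun i j hij => ?_⟩
    cases j using Fin.cases with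
    | zero => exact absurd hij (Fin.not_lt_zero i)
    | succ j =>
      have hBj : f (B j.succ) = (f.restrict hinv (b j) : LinearMap.ker φ) := by simp [B]
      rw [hBj, repr_mkFinCons_ker]
      cases i using Fin.cases with
      | zero => rfl
      | succ i => exact hb i j (Fin.succ_lt_succ_iff.1 hij)

theorem roots_charpoly_of_isLowerTriangular {n : Type*} [Fintype n] [LinearOrder n]
    {T : Matrix n n K} (hT : T.IsLowerTriangular) :
    T.charpoly.roots = Finset.univ.val.map fun i => T i i := by
  have hcharpoly : T.charpoly = ∏ i, (Polynomial.X - Polynomial.C (T i i)) :=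
    T.charpoly_transpose.symm.trans (Matrix.charpoly_of_isUpperTriangular _ hT.transpose)
  rw [hcharpoly,
    Polynomial.roots_prod _ _ (by simp [Finset.prod_ne_zero_iff, Polynomial.X_sub_C_ne_zero])]
  simp

theorem exists_isLowerTriangular [IsAlgClosed K] {n : ℕ} (B : Matrix (Fin n) (Fin n) K) :
    ∃ P Q T : Matrix (Fin n) (Fin n) K, Q * P = 1 ∧ B = P * T * Q ∧
      T.IsLowerTriangular ∧ T.charpoly = B.charpoly := by
  obtain ⟨b, hb⟩ := exists_triangular_basis n (by simp) (Matrix.toLin' B)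
  let e := Pi.basisFun K (Fin n)
  refine ⟨e.toMatrix b, b.toMatrix e, LinearMap.toMatrix b b (Matrix.toLin' B),
    b.toMatrix_mul_toMatrix_flip e, ?_, ?_, ?_⟩
  · rw [basis_toMatrix_mul_linearMap_toMatrix_mul_basis_toMatrix]
    exact (LinearMap.toMatrix'_toLin' B).symm
  · intro i j hij
    rw [LinearMap.toMatrix_apply]
    exact hb i j hij
  · rw [LinearMap.charpoly_toMatrix, ← LinearMap.charpoly_toMatrix _ e]
    exact congrArg _ (LinearMap.toMatrix'_toLin' B)

end Triangular

/-! ### Power sums and functions constant on cycles -/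

section Cycles

theorem eq_of_sameCycle {α ι : Type*} [Finite α] {g : Equiv.Perm α} {J : α → ι}
    (hJ : ∀ k, J (g k) = J k) {k k' : α} (h : g.SameCycle k k') : J k = J k' := by
  obtain ⟨n, rfl⟩ := h.exists_nat_pow_eq
  clear h
  induction n with
  | zero => rfl
  | succ n ih => rw [pow_succ', Equiv.Perm.mul_apply, hJ, ih]

variable {α : Type*} [Fintype α] [DecidableEq α] (g : Equiv.Perm α)

/-- The set of cycles of a permutation, fixed points included. -/
abbrev Cycles : Type _ := g.cycleFactorsFinset ⊕ {k : α // k ∉ g.support}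

/-- The cycle through an element. -/
def toCycle (k : α) : Cycles g :=
  if h : k ∈ g.support then
    Sum.inl ⟨g.cycleOf k, Equiv.Perm.cycleOf_mem_cycleFactorsFinset_iff.2 h⟩
  else Sum.inr ⟨k, h⟩

theorem toCycle_eq_inl {k : α} {c : g.cycleFactorsFinset} :
    toCycle g k = Sum.inl c ↔ k ∈ c.1.support := by
  rw [← Equiv.Perm.eq_cycleOf_of_mem_cycleFactorsFinset_iff g c.1 c.2 k, toCycle]
  split_ifs with h
  · simp [Subtype.ext_iff, eq_comm]
  · simp only [false_iff]
    intro hc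
    exact h (Equiv.Perm.cycleOf_mem_cycleFactorsFinset_iff.1 (hc ▸ c.2))

theorem toCycle_eq_inr {k : α} {c : {k : α // k ∉ g.support}} :
    toCycle g k = Sum.inr c ↔ k = c.1 := by
  rw [toCycle]
  split_ifs with h
  · simp only [false_iff]
    rintro rfl
    exact c.2 h
  · simp [Subtype.ext_iff]

theorem toCycle_surjective : Function.Surjective (toCycle g) := by
  rintro (c | c)
  · obtain ⟨x, hx⟩ := (Equiv.Perm.mem_cycleFactorsFinset_iff.1 c.2).1.nonempty_support
    exact ⟨x, (toCycle_eq_inl g).2 hx⟩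
  · exact ⟨c.1, (toCycle_eq_inr g).2 rfl⟩

theorem toCycle_apply (k : α) : toCycle g (g k) = toCycle g k := by
  by_cases h : k ∈ g.support
  · have h' : g k ∈ g.support := Equiv.Perm.apply_mem_support.2 h
    have hcycle : g.cycleOf (g k) = g.cycleOf k := Equiv.Perm.cycleOf_self_apply g k
    simp only [toCycle, dif_pos h, dif_pos h', hcycle]
  · rw [Equiv.Perm.notMem_support.1 h]

theorem sameCycle_of_toCycle_eq {k k' : α} (h : toCycle g k = toCycle g k') :
    g.SameCycle k k' := by
  rcases hk : toCycle g k with c | c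
  · have hmem := (toCycle_eq_inl g).1 hk
    have hmem' := (toCycle_eq_inl g).1 (h.symm.trans hk)
    rw [← Equiv.Perm.eq_cycleOf_of_mem_cycleFactorsFinset_iff g c.1 c.2] at hmem hmem'
    have hsupp := Equiv.Perm.cycleOf_mem_cycleFactorsFinset_iff.1 (hmem ▸ c.2)
    have hsupp' := Equiv.Perm.cycleOf_mem_cycleFactorsFinset_iff.1 (hmem' ▸ c.2)
    exact (Equiv.Perm.sameCycle_iff_cycleOf_eq_of_mem_support hsupp hsupp').2
      (hmem.symm.trans hmem')
  · rw [(toCycle_eq_inr g).1 hk, (toCycle_eq_inr g).1 (h.symm.trans hk)]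

variable {ι : Type*} [Fintype ι] {R : Type*} [CommRing R]

theorem eval_psum (t : ι → R) (m : ℕ) :
    MvPolynomial.eval t (MvPolynomial.psum ι R m) = ∑ j, t j ^ m := by
  simp [MvPolynomial.psum]

theorem eval_psumPart_congr {n : ℕ} {a b : ι → R}
    (h : Finset.univ.val.map a = Finset.univ.val.map b) (μ : n.Partition) :
    MvPolynomial.eval a (MvPolynomial.psumPart ι R μ) =
      MvPolynomial.eval b (MvPolynomial.psumPart ι R μ) := by
  have hpsum : ∀ m, MvPolynomial.eval a (MvPolynomial.psum ι R m) =
      MvPolynomial.eval b (MvPolynomial.psum ι R m) := fun m => by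
    have hmap := congrArg (fun s => (s.map (· ^ m)).sum) h
    simp only [Multiset.map_map] at hmap
    rw [eval_psum, eval_psum]
    exact hmap
  rw [MvPolynomial.psumPart, map_multiset_prod, map_multiset_prod, Multiset.map_map,
    Multiset.map_map]
  congr 1
  exact Multiset.map_congr rfl fun m _ => hpsum m

variable [DecidableEq ι]

theorem sum_invariant_eq_prod_cycles (t : ι → R) :
    ∑ J : α → ι with ∀ k, J (g k) = J k, ∏ k, t (J k) =
      ∏ c : Cycles g, ∑ j, t j ^ (Finset.univ.filter fun k => toCycle g k = c).card := by
  rw [Finset.prod_univ_sum, Fintype.piFinset_univ]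
  symm
  refine Finset.sum_bij (fun F _ => F ∘ toCycle g) ?_ ?_ ?_ ?_
  · intro F _
    simp [toCycle_apply]
  · intro F _ F' _ h
    exact (toCycle_surjective g).injective_comp_right h
  · intro J hJ
    rw [Finset.mem_filter] at hJ
    refine ⟨J ∘ Function.surjInv (toCycle_surjective g), Finset.mem_univ _, funext fun k => ?_⟩
    exact eq_of_sameCycle hJ.2
      (sameCycle_of_toCycle_eq g (Function.surjInv_eq (toCycle_surjective g) _))
  · intro F _
    rw [← Finset.prod_fiberwise _ (toCycle g)]
    refine Finset.prod_congr rfl fun c _ => ?_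
    rw [← Finset.prod_const]
    refine Finset.prod_congr rfl fun k hk => ?_
    rw [Function.comp_apply, (Finset.mem_filter.1 hk).2]

theorem sum_invariant_eq_psumPart (t : ι → R) :
    ∑ J : α → ι with ∀ k, J (g k) = J k, ∏ k, t (J k) =
      MvPolynomial.eval t (MvPolynomial.psumPart ι R g.partition) := by
  have hinl : ∀ c : g.cycleFactorsFinset,
      (Finset.univ.filter fun k => toCycle g k = Sum.inl c) = c.1.support := fun c => by
    ext k
    simp only [Finset.mem_filter, Finset.mem_univ, true_and, toCycle_eq_inl]
  have hinr : ∀ c : {k : α // k ∉ g.support},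
      (Finset.univ.filter fun k => toCycle g k = Sum.inr c) = {c.1} := fun c => by
    ext k
    simp only [Finset.mem_filter, Finset.mem_univ, true_and, toCycle_eq_inr, Finset.mem_singleton]
  have hcard : Fintype.card {k : α // k ∉ g.support} = Fintype.card α - g.support.card := by
    rw [Fintype.card_subtype_compl, Fintype.card_coe]
  rw [sum_invariant_eq_prod_cycles, Fintype.prod_sum_type, MvPolynomial.psumPart,
    Equiv.Perm.parts_partition, Multiset.map_add, Multiset.prod_add, map_mul,
    Multiset.map_replicate, Multiset.prod_replicate, map_pow, eval_psum, ← hcard]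
  congr 1
  · simp only [hinl]
    rw [map_multiset_prod, Multiset.map_map, Equiv.Perm.cycleType_def, Multiset.map_map,
      Finset.prod_coe_sort g.cycleFactorsFinset fun c => ∑ j, t j ^ c.support.card,
      Finset.prod]
    congr 1
    exact Multiset.map_congr rfl fun c _ => (eval_psum t _).symm
  · simp [hinr]

end Cycles

/-! ### Tensor powers of matrices and permutations of the tensor factors -/

section KronPow

variable (α : Type*) [Fintype α] {ι R : Type*} [CommSemiring R]

/-- The tensor power of a matrix, with factors indexed by `α`, in the standard basis. -/
def kronPow (X : Matrix ι ι R) : Matrix (α → ι) (α → ι) R :=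
  Matrix.of fun J L => ∏ k, X (J k) (L k)

theorem kronPow_apply (X : Matrix ι ι R) (J L : α → ι) :
    kronPow α X J L = ∏ k, X (J k) (L k) := rfl

theorem kronPow_one [DecidableEq ι] : kronPow α (1 : Matrix ι ι R) = 1 := by
  ext J L
  simp [kronPow_apply, Matrix.one_apply, Fintype.prod_ite_zero, funext_iff]

variable [DecidableEq α] [Fintype ι]

theorem kronPow_mul (X Y : Matrix ι ι R) : kronPow α (X * Y) = kronPow α X * kronPow α Y := by
  ext J L
  simp only [kronPow_apply, Matrix.mul_apply, Finset.prod_univ_sum, Fintype.piFinset_univ,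
    Finset.prod_mul_distrib]

theorem trace_kronPow (X : Matrix ι ι R) :
    (kronPow α X).trace = X.trace ^ Fintype.card α := by
  simp only [Matrix.trace, Matrix.diag_apply, kronPow_apply]
  rw [← Fintype.piFinset_univ, ← Finset.prod_univ_sum (fun _ => Finset.univ) fun _ i => X i i]
  simp

end KronPow

/-- Square matrices indexed by the standard basis of the `d`-th tensor power of `ℂ^N`. -/
abbrev TensorMatrix (N d : ℕ) : Type := Matrix (Fin d → Fin N) (Fin d → Fin N) ℂ

/-- The standard basis of the tensor power. -/
def tensorBasis (N d : ℕ) : Module.Basis (Fin d → Fin N) ℂ (TensorPow N d) :=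
  Basis.piTensorProduct fun _ => Pi.basisFun ℂ (Fin N)

instance (N d : ℕ) : FiniteDimensional ℂ (TensorPow N d) :=
  (tensorBasis N d).finiteDimensional_of_finite

/-- The action of the group algebra by permutation of the tensor factors, in the standard basis. -/
def rho (N d : ℕ) : PermAlgebra d →ₐ[ℂ] TensorMatrix N d :=
  (LinearMap.toMatrixAlgEquiv (tensorBasis N d)).toAlgHom.comp (permRep N d).asAlgebraHom

section Rho

variable {N d : ℕ}

theorem rho_single_apply (g : Equiv.Perm (Fin d)) (J L : Fin d → Fin N) :
    rho N d (MonoidAlgebra.single g 1) J L = if L = J ∘ g then 1 else 0 := by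
  have hrho : rho N d (MonoidAlgebra.single g 1) =
      LinearMap.toMatrix (tensorBasis N d) (tensorBasis N d) (permRep N d g) := by
    rw [← Representation.asAlgebraHom_single_one]
    rfl
  have hbasis : permRep N d g (tensorBasis N d L) = tensorBasis N d (L ∘ g.symm) := by
    simp only [tensorBasis, Basis.piTensorProduct_apply]
    exact PiTensorProduct.reindex_tprod _ _
  rw [hrho, LinearMap.toMatrix_apply, hbasis, Module.Basis.repr_self, Finsupp.single_apply]
  simp only [g.comp_symm_eq]

theorem rho_single_mul (g : Equiv.Perm (Fin d)) (M : TensorMatrix N d) (J L : Fin d → Fin N) :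
    (rho N d (MonoidAlgebra.single g 1) * M) J L = M (J ∘ g) L := by
  simp [Matrix.mul_apply, rho_single_apply]

theorem mul_rho_single (g : Equiv.Perm (Fin d)) (M : TensorMatrix N d) (J L : Fin d → Fin N) :
    (M * rho N d (MonoidAlgebra.single g 1)) J L = M J (L ∘ g.symm) := by
  simp [Matrix.mul_apply, rho_single_apply, ← g.comp_symm_eq]

theorem commute_rho_single_kronPow (g : Equiv.Perm (Fin d)) (X : Matrix (Fin N) (Fin N) ℂ) :
    Commute (rho N d (MonoidAlgebra.single g 1)) (kronPow (Fin d) X) := by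
  ext J L
  rw [rho_single_mul, mul_rho_single, kronPow_apply, kronPow_apply]
  exact Fintype.prod_equiv g _ _ fun k => by simp

theorem commute_rho_kronPow (x : PermAlgebra d) (X : Matrix (Fin N) (Fin N) ℂ) :
    Commute (rho N d x) (kronPow (Fin d) X) := by
  induction x using MonoidAlgebra.induction_on with
  | of g => exact commute_rho_single_kronPow g X
  | add a b ha hb => exact (map_add (rho N d) a b).symm ▸ ha.add_left hb
  | smul r a ha => exact (map_smul (rho N d) r a).symm ▸ ha.smul_left r

theorem trace_rho_single_mul_kronPow (g : Equiv.Perm (Fin d)) (X : Matrix (Fin N) (Fin N) ℂ) :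
    (rho N d (MonoidAlgebra.single g 1) * kronPow (Fin d) X).trace =
      ∑ J : Fin d → Fin N, ∏ k, X (J (g k)) (J k) := by
  simp only [Matrix.trace, Matrix.diag_apply, rho_single_mul, kronPow_apply, Function.comp_apply]

theorem trace_rho_single_mul_kronPow_conj (g : Equiv.Perm (Fin d))
    {P Q : Matrix (Fin N) (Fin N) ℂ} (hQP : Q * P = 1) (X : Matrix (Fin N) (Fin N) ℂ) :
    (rho N d (MonoidAlgebra.single g 1) * kronPow (Fin d) (P * X * Q)).trace =
      (rho N d (MonoidAlgebra.single g 1) * kronPow (Fin d) X).trace := by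
  rw [kronPow_mul, kronPow_mul, ← mul_assoc, ← mul_assoc, (commute_rho_single_kronPow g P).eq,
    Matrix.trace_mul_comm, mul_assoc, ← mul_assoc (kronPow (Fin d) Q), ← kronPow_mul, hQP,
    kronPow_one, one_mul]

theorem prod_apply_comp_eq_zero_of_isLowerTriangular {α R : Type*} [Fintype α] [CommSemiring R]
    {n : ℕ} {T : Matrix (Fin n) (Fin n) R} (hT : T.IsLowerTriangular) (g : Equiv.Perm α)
    {J : α → Fin n} (hJ : ¬ ∀ k, J (g k) = J k) : ∏ k, T (J (g k)) (J k) = 0 := by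
  by_contra hne
  have hle : ∀ k ∈ Finset.univ, (J k : ℕ) ≤ J (g k) := fun k _ => by
    by_contra! hlt
    exact hne (Finset.prod_eq_zero (Finset.mem_univ k) (hT hlt))
  have hsum : ∑ k, (J k : ℕ) = ∑ k, (J (g k) : ℕ) :=
    (Equiv.sum_comp g fun k => (J k : ℕ)).symm
  exact hJ fun k =>
    Fin.ext ((Finset.sum_eq_sum_iff_of_le hle).1 hsum k (Finset.mem_univ k)).symm

theorem trace_rho_single_mul_kronPow_of_isLowerTriangular (g : Equiv.Perm (Fin d))
    {T : Matrix (Fin N) (Fin N) ℂ} (hT : T.IsLowerTriangular) :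
    (rho N d (MonoidAlgebra.single g 1) * kronPow (Fin d) T).trace =
      MvPolynomial.eval (fun i => T i i) (MvPolynomial.psumPart (Fin N) ℂ g.partition) := by
  rw [← sum_invariant_eq_psumPart, trace_rho_single_mul_kronPow, Finset.sum_filter]
  refine Finset.sum_congr rfl fun J _ => ?_
  split_ifs with h
  · exact Finset.prod_congr rfl fun k _ => by rw [h]
  · exact prod_apply_comp_eq_zero_of_isLowerTriangular hT g h

theorem trace_rho_single_mul_kronPow_eq_psumPart (g : Equiv.Perm (Fin d))
    {B : Matrix (Fin N) (Fin N) ℂ} {b : Fin N → ℂ} (hb : AreEigenvalues B b) :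
    (rho N d (MonoidAlgebra.single g 1) * kronPow (Fin d) B).trace =
      MvPolynomial.eval b (MvPolynomial.psumPart (Fin N) ℂ g.partition) := by
  obtain ⟨P, Q, T, hQP, rfl, hT, hcharpoly⟩ := exists_isLowerTriangular B
  rw [AreEigenvalues, ← hcharpoly, roots_charpoly_of_isLowerTriangular hT] at hb
  rw [trace_rho_single_mul_kronPow_conj g hQP,
    trace_rho_single_mul_kronPow_of_isLowerTriangular g hT, eval_psumPart_congr hb]

/-! ### Traces of the idempotents on the tensor power -/

theorem dimW_eq_finrank (l : Shape d) : dimW N l.1 =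
    Module.finrank ℂ (LinearMap.range ((permRep N d).asAlgebraHom (youngIdem l))) := by
  obtain ⟨lam, rfl⟩ := l
  rw [← LinearMap.range_smul _ _ (youngScalar_ne_zero _), ← map_smul, ← youngSym_eq_smul_youngIdem]
  rfl

theorem trace_eq_finrank_range {k E : Type*} [Field k] [AddCommGroup E] [Module k E]
    [FiniteDimensional k E] {f : Module.End k E} (hf : IsIdempotentElem f) :
    LinearMap.trace k E f = Module.finrank k (LinearMap.range f) :=
  (LinearMap.IsIdempotentElem.isProj_range f hf).trace

theorem trace_rho_youngIdem (l : Shape d) : (rho N d (youngIdem l)).trace = dimW N l.1 := by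
  have hidem := (isSplitPrimitive_youngIdem l).isIdempotentElem.map (permRep N d).asAlgebraHom
  rw [dimW_eq_finrank, ← trace_eq_finrank_range hidem,
    LinearMap.trace_eq_matrix_trace ℂ (tensorBasis N d)]
  rfl

theorem rho_youngIdem_eq_zero {l : Shape d} (h : dimW N l.1 = 0) : rho N d (youngIdem l) = 0 := by
  rw [dimW_eq_finrank, Submodule.finrank_eq_zero, LinearMap.range_eq_bot] at h
  exact (LinearMap.toMatrixAlgEquiv (tensorBasis N d)).map_eq_zero_iff.2 h

theorem rho_youngCent_eq_zero {l : Shape d} (h : dimW N l.1 = 0) : rho N d (youngCent l) = 0 := by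
  simp [youngCent_eq, conjSum, rho_youngIdem_eq_zero h]

theorem trace_rho_conjSum_mul_kronPow (x : PermAlgebra d) (X : Matrix (Fin N) (Fin N) ℂ) :
    (rho N d (conjSum x) * kronPow (Fin d) X).trace =
      d.factorial * (rho N d x * kronPow (Fin d) X).trace := by
  have hconj : ∀ g : Equiv.Perm (Fin d), (rho N d (MonoidAlgebra.single g 1 * x *
      MonoidAlgebra.single g⁻¹ 1) * kronPow (Fin d) X).trace =
        (rho N d x * kronPow (Fin d) X).trace := fun g => by
    rw [map_mul, mul_assoc, (commute_rho_single_kronPow _ X).eq, ← mul_assoc,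
      Matrix.trace_mul_comm, ← mul_assoc, ← map_mul, ← mul_assoc,
      MonoidAlgebra.single_mul_single, inv_mul_cancel, mul_one, ← MonoidAlgebra.one_def, one_mul]
  rw [conjSum, map_sum, Finset.sum_mul, Matrix.trace_sum, Finset.sum_congr rfl fun g _ => hconj g]
  simp [Fintype.card_perm]

theorem trace_rho_youngCent_mul_kronPow (l : Shape d) (X : Matrix (Fin N) (Fin N) ℂ) :
    (rho N d (youngCent l) * kronPow (Fin d) X).trace =
      dimV l.1 * (rho N d (youngIdem l) * kronPow (Fin d) X).trace := by
  have hd : (d.factorial : ℂ) ≠ 0 := by exact_mod_cast d.factorial_ne_zero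
  rw [youngCent_eq, map_smul, smul_mul_assoc, Matrix.trace_smul, trace_rho_conjSum_mul_kronPow,
    smul_eq_mul, ← mul_assoc, div_mul_cancel₀ _ hd]

theorem trace_rho_youngCent (l : Shape d) :
    (rho N d (youngCent l)).trace = dimV l.1 * dimW N l.1 := by
  simpa [kronPow_one, trace_rho_youngIdem] using trace_rho_youngCent_mul_kronPow (N := N) l 1

theorem sum_dimV_mul_dimW (N d : ℕ) : ∑ l : Shape d, dimV l.1 * dimW N l.1 = N ^ d := by
  have htrace := congrArg (fun x => (rho N d x).trace)
    (completeOrthogonalIdempotents_youngCent d).complete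
  simp only [map_sum, Matrix.trace_sum, trace_rho_youngCent, map_one, Matrix.trace_one,
    Fintype.card_fun, Fintype.card_fin] at htrace
  exact_mod_cast htrace

theorem trace_rho_youngIdem_mul_kronPow (l : Shape d) {B : Matrix (Fin N) (Fin N) ℂ} {b : Fin N → ℂ}
    (hb : AreEigenvalues B b) :
    (rho N d (youngIdem l) * kronPow (Fin d) B).trace = MvPolynomial.eval b (schur N l.1) := by
  obtain ⟨lam, rfl⟩ := l
  have hfact : (lam.card.factorial : ℂ) ≠ 0 := by exact_mod_cast lam.card.factorial_ne_zero
  have hinv : ∀ g : Equiv.Perm (Fin lam.card), g⁻¹.partition = g.partition := fun g =>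
    Equiv.Perm.partition_eq_of_isConj.1
      (by rw [Equiv.Perm.isConj_iff_cycleType_eq, Equiv.Perm.cycleType_inv])
  rw [schur, map_mul, MvPolynomial.eval_C, eq_inv_mul_iff_mul_eq₀ hfact,
    ← trace_rho_conjSum_mul_kronPow, eq_sum_coeff_smul_single (conjSum _), map_sum, map_sum,
    Finset.sum_mul, Matrix.trace_sum]
  refine Fintype.sum_equiv (Equiv.inv _) _ _ fun g => ?_
  rw [map_smul, smul_mul_assoc, Matrix.trace_smul, trace_rho_single_mul_kronPow_eq_psumPart _ hb,
    map_mul, MvPolynomial.eval_C, character_Vrep, Equiv.inv_apply, inv_inv, hinv, smul_eq_mul]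

/-! ### Diagrams with too many rows -/

theorem exists_ne_colOf_eq {lam : YoungDiagram} (t : lam.cells ≃ Fin d) (h : N < numRows lam)
    (L : Fin d → Fin N) : ∃ e e', e ≠ e' ∧ colOf t e = colOf t e' ∧ L e = L e' := by
  have hmem : ∀ i : Fin (numRows lam), (i.1, 0) ∈ lam.cells := fun i =>
    (YoungDiagram.mem_cells _).2 (YoungDiagram.mem_iff_lt_colLen.2 i.2)
  let entry : Fin (numRows lam) → Fin d := fun i => t ⟨(i.1, 0), hmem i⟩
  obtain ⟨i, i', hne, hL⟩ := Fintype.exists_ne_map_eq_of_card_lt (L ∘ entry) (by simpa using h)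
  refine ⟨entry i, entry i', fun he => hne (Fin.ext ?_), by simp [entry, colOf], hL⟩
  exact congrArg (fun c => c.1.1) (t.injective he)

theorem rho_colSum_eq_zero {lam : YoungDiagram} (t : lam.cells ≃ Fin d) (h : N < numRows lam) :
    rho N d (colSum t) = 0 := by
  ext J L
  obtain ⟨e, e', hne, hcol, hL⟩ := exists_ne_colOf_eq t h L
  have hswap := charSum_mul_single_inv (signChar (Fin d)) (swap_mem_fiberPerms hcol)
  rw [signChar_swap hne, neg_one_smul, Equiv.swap_inv, ← colSum] at hswap
  have hentry := congrFun (congrFun (congrArg (rho N d) hswap) J) L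
  have hLswap : L ∘ (Equiv.swap e e').symm = L := by
    rw [Equiv.symm_swap, Equiv.comp_swap_eq_update, hL, Function.update_eq_self, ← hL,
      Function.update_eq_self]
  rw [map_mul, mul_rho_single, hLswap, map_neg, Matrix.neg_apply] at hentry
  exact self_eq_neg.1 hentry

theorem dimW_eq_zero {lam : YoungDiagram} (h : N < numRows lam) : dimW N lam = 0 := by
  have hidem : rho N lam.card (youngIdem ⟨lam, rfl⟩) = 0 := by
    rw [youngIdem, youngSym_mk, youngSymmetrizer_eq, map_smul, map_mul, rho_colSum_eq_zero _ h,
      mul_zero, smul_zero]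
  have htrace := trace_rho_youngIdem (N := N) (⟨lam, rfl⟩ : Shape lam.card)
  rw [hidem, Matrix.trace_zero] at htrace
  exact_mod_cast htrace.symm

end Rho

/-! ### Schur–Weyl duality -/

section Bicommutant

theorem exists_algHom_eq_of_forall_commute {k A M : Type*} [Field k] [Ring A] [Algebra k A]
    [IsSemisimpleRing A] [AddCommGroup M] [Module k M] [FiniteDimensional k M]
    (φ : A →ₐ[k] Module.End k M) (D : Module.End k M)
    (hD : ∀ C : Module.End k M, (∀ a, Commute (φ a) C) → Commute D C) : ∃ a, φ a = D := by
  classical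
  let : Module A M := Module.compHom M φ.toRingHom
  have : IsScalarTower k A M := .of_algebraMap_smul fun r x => by
    change φ (algebraMap k A r) x = r • x
    rw [φ.commutes, Module.algebraMap_end_apply]
  let f : Module.End (Module.End A M) M :=
    { toFun := D
      map_add' := map_add D
      map_smul' := fun C x =>
        LinearMap.congr_fun (hD (C.restrictScalars k) fun a => by
          ext y
          exact (C.map_smul a y).symm) x }
  let b := Module.finBasis k M
  obtain ⟨a, ha⟩ := jacobson_density f (Finset.univ.image b)
  exact ⟨a, b.ext fun i => (ha (b i) (Finset.mem_image_of_mem b (Finset.mem_univ i))).symm⟩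

theorem exists_rho_eq_of_forall_commute {N d : ℕ} (D : TensorMatrix N d)
    (hD : ∀ C : TensorMatrix N d, (∀ x, Commute (rho N d x) C) → Commute D C) :
    ∃ x, rho N d x = D := by
  let e := Matrix.toLinAlgEquiv' (R := ℂ) (n := Fin d → Fin N)
  obtain ⟨x, hx⟩ := exists_algHom_eq_of_forall_commute (e.toAlgHom.comp (rho N d)) (e D) fun C hC =>
    e.apply_symm_apply C ▸ (hD (e.symm C) fun x =>
      e.symm_apply_apply (rho N d x) ▸ (hC x).map e.symm).map e
  exact ⟨x, e.injective hx⟩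

end Bicommutant

section GenericMatrix

theorem exists_perm_comp_eq {α β : Type*} [Fintype α] {f g : α → β}
    (h : ∑ k, Finsupp.single (f k) 1 = ∑ k, Finsupp.single (g k) 1) :
    ∃ σ : Equiv.Perm α, g ∘ σ = f := by
  classical
  have hcard : ∀ c, Fintype.card {k // f k = c} = Fintype.card {k // g k = c} := fun c => by
    have hc := DFunLike.congr_fun h c
    simpa [Finsupp.finsetSum_apply, Finsupp.single_apply, Fintype.card_subtype] using hc
  exact ⟨Equiv.ofFiberEquiv fun c => Fintype.equivOfCardEq (hcard c),
    funext fun k => Equiv.ofFiberEquiv_map _ k⟩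

variable {α ι R : Type*} [Fintype α] [CommSemiring R]

theorem kronPow_mvPolynomialX_apply (J L : α → ι) :
    kronPow α (Matrix.mvPolynomialX ι ι R) J L =
      MvPolynomial.monomial (∑ k, Finsupp.single (J k, L k) 1) 1 :=
  (MvPolynomial.monomial_sum_one _ _).symm

/-- A permutation-invariant matrix `C` depends on `J`, `L` only through the monomial
`∏ k, X (J k, L k)`, so sending each monomial to the entry of `C` is a well defined linear map. -/
theorem exists_linearMap_kronPow_mvPolynomialX {C : Matrix (α → ι) (α → ι) R}
    (hC : ∀ (g : Equiv.Perm α) J L, C (J ∘ g) (L ∘ g) = C J L) :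
    ∃ Λ : MvPolynomial (ι × ι) R →ₗ[R] R,
      ∀ J L, Λ (kronPow α (Matrix.mvPolynomialX ι ι R) J L) = C J L := by
  let m : (α → ι) × (α → ι) → ι × ι →₀ ℕ := fun p => ∑ k, Finsupp.single (p.1 k, p.2 k) 1
  have hfactors : Function.FactorsThrough (fun p : (α → ι) × (α → ι) => C p.1 p.2) m := by
    rintro ⟨J, L⟩ ⟨J', L'⟩ h
    obtain ⟨g, hg⟩ := exists_perm_comp_eq h
    obtain rfl : J' ∘ g = J := congrArg (Prod.fst ∘ ·) hg
    obtain rfl : L' ∘ g = L := congrArg (Prod.snd ∘ ·) hg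
    exact hC g J' L'
  let b := MvPolynomial.basisMonomials (ι × ι) R
  refine ⟨b.constr R (Function.extend m (fun p => C p.1 p.2) 0), fun J L => ?_⟩
  rw [kronPow_mvPolynomialX_apply]
  exact (b.constr_basis R _ _).trans (hfactors.extend_apply 0 (J, L))

theorem commute_of_commute_kronPow_mvPolynomialX [DecidableEq α] [Fintype ι]
    {C D : Matrix (α → ι) (α → ι) R}
    (hD : Commute (D.map MvPolynomial.C) (kronPow α (Matrix.mvPolynomialX ι ι R)))
    (hC : ∀ (g : Equiv.Perm α) J L, C (J ∘ g) (L ∘ g) = C J L) : Commute D C := by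
  obtain ⟨Λ, hΛ⟩ := exists_linearMap_kronPow_mvPolynomialX hC
  ext J L
  have hJL := congrArg Λ (congrFun (congrFun hD J) L)
  simpa only [Matrix.mul_apply, Matrix.map_apply, mul_comm _ (MvPolynomial.C _), map_sum,
    ← MvPolynomial.smul_eq_C_mul, map_smul, hΛ, smul_eq_mul, mul_comm (D _ L)] using hJL

end GenericMatrix

/-! ### Zariski density of the unitary group -/

section Unitary

variable {ι : Type*} [Fintype ι] [DecidableEq ι]

theorem infinite_unit_circle : (Metric.sphere (0 : ℂ) 1).Infinite :=
  (isPreconnected_sphere (by simp) (0 : ℂ) 1).infinite_of_nontrivial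
    ⟨1, by simp, -1, by simp, by norm_num⟩

theorem diagonal_mem_unitaryGroup {y : ι → ℂ} (hy : ∀ i, ‖y i‖ = 1) :
    Matrix.diagonal y ∈ Matrix.unitaryGroup ι ℂ := by
  rw [Matrix.mem_unitaryGroup_iff', Matrix.star_eq_conjTranspose, Matrix.diagonal_conjTranspose,
    Matrix.diagonal_mul_diagonal, ← Matrix.diagonal_one]
  congr 1
  funext i
  simp [Complex.conj_mul', hy]

open scoped ComplexOrder in
theorem exists_conjTranspose_mul_self_eq {X : Matrix ι ι ℂ} (hX : IsUnit X) :
    ∃ (w : Matrix.unitaryGroup ι ℂ) (s : ι → ℝ), (∀ i, s i ≠ 0) ∧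
      X.conjTranspose * X = w.1 * Matrix.diagonal (fun i => (s i : ℂ) ^ 2) * star w.1 := by
  have hpos : (X.conjTranspose * X).PosDef :=
    Matrix.PosDef.conjTranspose_mul_self X (Matrix.mulVec_injective_of_isUnit hX)
  refine ⟨hpos.isHermitian.eigenvectorUnitary, fun i => √(hpos.isHermitian.eigenvalues i),
    fun i => (Real.sqrt_pos.2 (hpos.eigenvalues_pos i)).ne', ?_⟩
  simp only [← Complex.ofReal_pow, Real.sq_sqrt (hpos.eigenvalues_pos _).le]
  exact hpos.isHermitian.spectral_theorem

theorem exists_eq_unitary_mul_diagonal_mul_unitary {X : Matrix ι ι ℂ} (hX : IsUnit X) :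
    ∃ (u v : Matrix.unitaryGroup ι ℂ) (x : ι → ℂ), X = u.1 * Matrix.diagonal x * v.1 := by
  obtain ⟨w, s, hs, hspec⟩ := exists_conjTranspose_mul_self_eq hX
  have hww : star w.1 * w.1 = 1 := Matrix.mem_unitaryGroup_iff'.1 w.2
  let S : Matrix ι ι ℂ := Matrix.diagonal fun i => (s i : ℂ)
  let S' : Matrix ι ι ℂ := Matrix.diagonal fun i => (s i : ℂ)⁻¹
  have hS : Matrix.diagonal (fun i => (s i : ℂ) ^ 2) = S * S := by
    simp only [S, Matrix.diagonal_mul_diagonal, sq]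
  have hSS' : S * S' = 1 := by simp [S, S', hs]
  have hS'S : S' * S = 1 := by simp [S, S', hs]
  have hstar : star S' = S' := by simp [S', Matrix.star_eq_conjTranspose, Pi.star_def]
  have hu : X * w.1 * S' ∈ Matrix.unitaryGroup ι ℂ := by
    rw [Matrix.mem_unitaryGroup_iff']
    calc star (X * w.1 * S') * (X * w.1 * S')
        = S' * star w.1 * (X.conjTranspose * X) * w.1 * S' := by
          simp only [star_mul, hstar, Matrix.star_eq_conjTranspose, mul_assoc]
      _ = S' * (star w.1 * w.1) * S * S * (star w.1 * w.1) * S' := by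
          rw [hspec, hS]
          simp only [mul_assoc]
      _ = 1 := by rw [hww, mul_one, mul_one, hS'S, one_mul, hSS']
  refine ⟨⟨_, hu⟩, star w, fun i => (s i : ℂ), ?_⟩
  change X = X * w.1 * S' * S * star w.1
  rw [mul_assoc (X * w.1), hS'S, mul_one, mul_assoc, Matrix.mem_unitaryGroup_iff.1 w.2, mul_one]

theorem mul_diagonal_mul_apply {R : Type*} [NonUnitalSemiring R] (X Y : Matrix ι ι R) (x : ι → R)
    (i j : ι) : (X * Matrix.diagonal x * Y) i j = ∑ k, X i k * x k * Y k j := by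
  simp only [Matrix.mul_apply (M := X * _), Matrix.mul_diagonal]

theorem eval_mul_diagonal_mul_eq_zero {P : MvPolynomial (ι × ι) ℂ}
    (hP : ∀ u : Matrix.unitaryGroup ι ℂ, MvPolynomial.eval (fun p => u.1 p.1 p.2) P = 0)
    (u v : Matrix.unitaryGroup ι ℂ) (x : ι → ℂ) :
    MvPolynomial.eval (fun p => (u.1 * Matrix.diagonal x * v.1) p.1 p.2) P = 0 := by
  let entry : ι × ι → MvPolynomial ι ℂ := fun p =>
    ∑ i, MvPolynomial.C (u.1 p.1 i) * MvPolynomial.X i * MvPolynomial.C (v.1 i p.2)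
  have hentry : ∀ y p, MvPolynomial.eval y (entry p) =
      (u.1 * Matrix.diagonal y * v.1) p.1 p.2 := fun y p => by
    simp only [entry, map_sum, map_mul, MvPolynomial.eval_C, MvPolynomial.eval_X,
      mul_diagonal_mul_apply]
  have hQ : ∀ y, MvPolynomial.eval y (MvPolynomial.bind₁ entry P) =
      MvPolynomial.eval (fun p => (u.1 * Matrix.diagonal y * v.1) p.1 p.2) P := fun y =>
    (MvPolynomial.eval₂Hom_bind₁ _ _ _ _).trans
      (congrArg (fun s => MvPolynomial.eval s P) (funext (hentry y)))
  have hQ0 : MvPolynomial.bind₁ entry P = 0 :=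
    MvPolynomial.funext_set (fun _ => Metric.sphere (0 : ℂ) 1)
      (fun _ => infinite_unit_circle) fun y hy => by
        have hdiag : Matrix.diagonal y ∈ Matrix.unitaryGroup ι ℂ :=
          diagonal_mem_unitaryGroup fun i => mem_sphere_zero_iff_norm.1 (hy i (Set.mem_univ i))
        rw [hQ, map_zero]
        exact hP ⟨_, mul_mem (mul_mem u.2 hdiag) v.2⟩
  rw [← hQ, hQ0, map_zero]

theorem eq_zero_of_forall_eval_unitary_eq_zero {P : MvPolynomial (ι × ι) ℂ}
    (hP : ∀ u : Matrix.unitaryGroup ι ℂ, MvPolynomial.eval (fun p => u.1 p.1 p.2) P = 0) :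
    P = 0 := by
  have hmul : P * (Matrix.mvPolynomialX ι ι ℂ).det = 0 := MvPolynomial.funext fun s => by
    rw [map_mul, map_zero, Matrix.eval_det_mvPolynomialX, mul_eq_zero, or_iff_not_imp_right]
    intro hdet
    obtain ⟨u, v, x, hs⟩ := exists_eq_unitary_mul_diagonal_mul_unitary
      ((Matrix.isUnit_iff_isUnit_det _).2 (isUnit_iff_ne_zero.2 hdet))
    have h := eval_mul_diagonal_mul_eq_zero hP u v x
    rwa [← hs] at h
  exact (mul_eq_zero.1 hmul).resolve_right (Matrix.det_mvPolynomialX_ne_zero ι ℂ)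

theorem commute_kronPow_mvPolynomialX_of_unitary {α : Type*} [Fintype α] [DecidableEq α]
    {D : Matrix (α → ι) (α → ι) ℂ}
    (hD : ∀ u : Matrix.unitaryGroup ι ℂ, Commute D (kronPow α u.1)) :
    Commute (D.map MvPolynomial.C) (kronPow α (Matrix.mvPolynomialX ι ι ℂ)) := by
  ext1 J L
  refine sub_eq_zero.1 (eq_zero_of_forall_eval_unitary_eq_zero fun u => ?_)
  have hJL := congrFun (congrFun (hD u) J) L
  simpa [Matrix.mul_apply, kronPow_apply, sub_eq_zero] using hJL

theorem exists_rho_eq_of_commute_unitary {N d : ℕ} (D : TensorMatrix N d)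
    (hD : ∀ u : U N, Commute D (kronPow (Fin d) u.1)) : ∃ x, rho N d x = D := by
  refine exists_rho_eq_of_forall_commute D fun C hC =>
    commute_of_commute_kronPow_mvPolynomialX (commute_kronPow_mvPolynomialX_of_unitary hD) ?_
  intro g J L
  have hJL := congrFun (congrFun (hC (MonoidAlgebra.single g 1)) J) (L ∘ g)
  rw [rho_single_mul, mul_rho_single] at hJL
  rw [hJL, Function.comp_assoc, Equiv.self_comp_symm, Function.comp_id]

end Unitary

/-! ### Averaging over the unitary group -/

section EntryIntegral

open MeasureTheory

variable {X m n : Type*} [MeasurableSpace X]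

/-- The entrywise integral of a matrix-valued function. -/
def entryIntegral (μ : Measure X) (F : X → Matrix m n ℂ) : Matrix m n ℂ :=
  Matrix.of fun i j => ∫ x, F x i j ∂μ

theorem linearMap_entryIntegral [Finite m] [Finite n] {μ : Measure X} {F : X → Matrix m n ℂ}
    (hF : ∀ i j, Integrable (fun x => F x i j) μ) (T : Matrix m n ℂ →ₗ[ℂ] ℂ) :
    T (entryIntegral μ F) = ∫ x, T (F x) ∂μ := by
  classical
  have := Fintype.ofFinite m
  have := Fintype.ofFinite n
  have hT : ∀ M, T M = ∑ i, ∑ j, M i j * T (Matrix.single i j 1) := fun M => by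
    conv_lhs => rw [Matrix.matrix_eq_sum_single M, map_sum]
    refine Finset.sum_congr rfl fun i _ => ?_
    rw [map_sum]
    refine Finset.sum_congr rfl fun j _ => ?_
    rw [← smul_eq_mul, ← map_smul, Matrix.smul_single, smul_eq_mul, mul_one]
  simp only [hT (F _), hT (entryIntegral μ F)]
  have hint : ∀ i j, Integrable (fun x => F x i j * T (Matrix.single i j 1)) μ :=
    fun i j => (hF i j).mul_const _
  rw [integral_finsetSum _ fun i _ => integrable_finsetSum _ fun j _ => hint i j]
  refine Finset.sum_congr rfl fun i _ => ?_
  rw [integral_finsetSum _ fun j _ => hint i j]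
  exact Finset.sum_congr rfl fun j _ => (integral_mul_const _ _).symm

end EntryIntegral

section Average

open MeasureTheory

variable {N d : ℕ}

instance (N : ℕ) : (haarU N).IsHaarMeasure :=
  inferInstanceAs (Measure.haarMeasure _).IsHaarMeasure

instance (N : ℕ) : IsProbabilityMeasure (haarU N) where
  measure_univ := Measure.haarMeasure_self (K₀ := (⊤ : TopologicalSpace.PositiveCompacts (U N)))

theorem integrable_haarU_of_continuous {f : U N → ℂ} (hf : Continuous f) :
    Integrable f (haarU N) :=
  hf.integrable_of_hasCompactSupport (HasCompactSupport.of_compactSpace f)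

/-- The representation of the unitary group on the tensor power, in the standard basis. -/
def unitaryTensor (N d : ℕ) : U N →* TensorMatrix N d where
  toFun u := kronPow (Fin d) u.1
  map_one' := kronPow_one (Fin d)
  map_mul' u v := kronPow_mul (Fin d) u.1 v.1

theorem unitaryTensor_apply (u : U N) : unitaryTensor N d u = kronPow (Fin d) u.1 := rfl

theorem unitaryTensor_inv_mul (u : U N) : unitaryTensor N d u⁻¹ * unitaryTensor N d u = 1 := by
  rw [← map_mul, inv_mul_cancel, map_one]

theorem continuous_unitaryTensor : Continuous (unitaryTensor N d) := by
  refine continuous_matrix fun J L => ?_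
  simp only [unitaryTensor_apply, kronPow_apply]
  exact continuous_finsetProd _ fun k _ => continuous_subtype_val.matrix_elem (J k) (L k)

theorem continuous_unitaryTensor_conj (M : TensorMatrix N d) :
    Continuous fun u => unitaryTensor N d u * M * unitaryTensor N d u⁻¹ :=
  (continuous_unitaryTensor.matrix_mul continuous_const).matrix_mul
    (continuous_unitaryTensor.comp continuous_inv)

/-- The average of a matrix over conjugation by tensor powers of unitary matrices. -/
def average (M : TensorMatrix N d) : TensorMatrix N d :=
  entryIntegral (haarU N) fun u => unitaryTensor N d u * M * unitaryTensor N d u⁻¹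

theorem linearMap_average (T : TensorMatrix N d →ₗ[ℂ] ℂ) (M : TensorMatrix N d) :
    T (average M) = ∫ u, T (unitaryTensor N d u * M * unitaryTensor N d u⁻¹) ∂(haarU N) :=
  linearMap_entryIntegral (fun J L => integrable_haarU_of_continuous
    ((continuous_unitaryTensor_conj M).matrix_elem J L)) T

theorem mul_average_mul_apply (P M Q : TensorMatrix N d) (J L : Fin d → Fin N) :
    (P * average M * Q) J L =
      ∫ u, (P * (unitaryTensor N d u * M * unitaryTensor N d u⁻¹) * Q) J L ∂(haarU N) :=
  linearMap_average (Matrix.entryLinearMap ℂ ℂ J L ∘ₗ LinearMap.mulRight ℂ Q ∘ₗ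
    LinearMap.mulLeft ℂ P) M

theorem trace_mul_average (P M : TensorMatrix N d) : (P * average M).trace =
    ∫ u, (P * (unitaryTensor N d u * M * unitaryTensor N d u⁻¹)).trace ∂(haarU N) :=
  linearMap_average (Matrix.traceLinearMap _ ℂ ℂ ∘ₗ LinearMap.mulLeft ℂ P) M

theorem commute_average_unitaryTensor (M : TensorMatrix N d) (v : U N) :
    Commute (average M) (unitaryTensor N d v) := by
  ext J L
  have hright := mul_average_mul_apply 1 M (unitaryTensor N d v) J L
  have hleft := mul_average_mul_apply (unitaryTensor N d v) M 1 J L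
  simp only [one_mul, mul_one] at hright hleft
  rw [hright, hleft, ← integral_mul_left_eq_self _ v]
  congr 1
  funext u
  simp only [mul_inv_rev, map_mul, mul_assoc, unitaryTensor_inv_mul, mul_one]

theorem exists_rho_eq_average (M : TensorMatrix N d) : ∃ x, rho N d x = average M :=
  exists_rho_eq_of_commute_unitary _ (commute_average_unitaryTensor M)

theorem trace_rho_mul_average (x : PermAlgebra d) (M : TensorMatrix N d) :
    (rho N d x * average M).trace = (rho N d x * M).trace := by
  have hconj : ∀ u : U N,
      (rho N d x * (unitaryTensor N d u * M * unitaryTensor N d u⁻¹)).trace =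
      (rho N d x * M).trace := fun u => by
    have hcomm := (commute_rho_kronPow (N := N) x u.1).eq
    rw [← unitaryTensor_apply] at hcomm
    rw [← mul_assoc, Matrix.trace_mul_comm, ← mul_assoc (rho N d x), hcomm, mul_assoc,
      ← mul_assoc, unitaryTensor_inv_mul, one_mul]
  simp only [trace_mul_average, hconj, integral_const, probReal_univ, one_smul]

end Average

/-! ### Traces against permutations -/

section PermTrace

variable {N d : ℕ}

/-- The element `∑ g, tr (g⁻¹ M) g` of the group algebra. -/
def permTrace (M : TensorMatrix N d) : PermAlgebra d :=
  ∑ g : Equiv.Perm (Fin d),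
    (rho N d (MonoidAlgebra.single g⁻¹ 1) * M).trace • MonoidAlgebra.single g 1

theorem coeff_permTrace (M : TensorMatrix N d) (g : Equiv.Perm (Fin d)) :
    (permTrace M).coeff g = (rho N d (MonoidAlgebra.single g⁻¹ 1) * M).trace := by
  rw [permTrace, MonoidAlgebra.coeff_sum, Finsupp.finsetSum_apply]
  simp [Finsupp.single_apply]

theorem coeff_permTrace_mul_one (M : TensorMatrix N d) (x : PermAlgebra d) :
    (permTrace M * x).coeff 1 = (rho N d x * M).trace := by
  induction x using MonoidAlgebra.induction_on with
  | of g => simp [coeff_permTrace]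
  | add a b ha hb => simp [mul_add, add_mul, ha, hb]
  | smul r a ha => simp [ha]

theorem permTrace_rho_mul (x : PermAlgebra d) (M : TensorMatrix N d) :
    permTrace (rho N d x * M) = x * permTrace M := by
  refine MonoidAlgebra.coeff_injective (Finsupp.ext fun g => ?_)
  have hcoeff : (x * permTrace M).coeff g =
      (permTrace M * (MonoidAlgebra.single g⁻¹ 1 * x)).coeff 1 := by
    rw [coeff_mul_comm_one]
    simp [mul_assoc]
  rw [hcoeff, coeff_permTrace_mul_one, coeff_permTrace, map_mul, mul_assoc]

theorem permTrace_average (M : TensorMatrix N d) : permTrace (average M) = permTrace M := by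
  simp only [permTrace, trace_rho_mul_average]

theorem permTrace_mul_rho (M : TensorMatrix N d) (x : PermAlgebra d) :
    permTrace (M * rho N d x) = permTrace M * x := by
  refine MonoidAlgebra.coeff_injective (Finsupp.ext fun g => ?_)
  have hcoeff : (permTrace M * x).coeff g =
      (permTrace M * (x * MonoidAlgebra.single g⁻¹ 1)).coeff 1 := by
    rw [← mul_assoc]
    simp
  rw [hcoeff, coeff_permTrace_mul_one, coeff_permTrace, map_mul, mul_assoc,
    Matrix.trace_mul_comm (rho N d x), mul_assoc]

theorem permTrace_kronPow_mem_center (X : Matrix (Fin N) (Fin N) ℂ) :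
    permTrace (kronPow (Fin d) X) ∈ Subalgebra.center ℂ (PermAlgebra d) :=
  mem_center_of_forall_single fun g => by
    rw [← permTrace_rho_mul, (commute_rho_single_kronPow g X).eq, permTrace_mul_rho]

theorem permTrace_kronPow (X : Matrix (Fin N) (Fin N) ℂ) :
    permTrace (kronPow (Fin d) X) =
      ∑ l : Shape d,
        (youngScalar l * (rho N d (youngIdem l) * kronPow (Fin d) X).trace) • youngCent l := by
  rw [eq_sum_coeff_smul_youngCent (permTrace_kronPow_mem_center X)]
  simp only [coeff_permTrace_mul_one]

/-- The inverse of `permTrace 1` on the tensor power; its coefficients are the values of the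
Weingarten function. Shapes with `dimW = 0` contribute nothing, by `0⁻¹ = 0`. -/
def weingarten (N d : ℕ) : PermAlgebra d :=
  ∑ l : Shape d, (youngScalar l * dimW N l.1)⁻¹ • youngCent l

theorem sum_smul_youngCent_mul_weingarten (a : Shape d → ℂ) :
    (∑ l, a l • youngCent l) * weingarten N d =
      ∑ l : Shape d, (a l * (youngScalar l * dimW N l.1)⁻¹) • youngCent l := by
  rw [weingarten, Finset.mul_sum]
  refine Finset.sum_congr rfl fun l _ => ?_
  rw [mul_smul_comm, sum_smul_mul_eq_smul
    (completeOrthogonalIdempotents_youngCent d).toOrthogonalIdempotents, smul_smul, mul_comm]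

theorem rho_permTrace_one_mul_weingarten :
    rho N d (permTrace (1 : TensorMatrix N d) * weingarten N d) = 1 := by
  have hone : ∑ l : Shape d, rho N d (youngCent l) = 1 := by
    rw [← map_sum, (completeOrthogonalIdempotents_youngCent d).complete, map_one]
  rw [← kronPow_one, permTrace_kronPow, sum_smul_youngCent_mul_weingarten, map_sum, kronPow_one]
  refine Eq.trans (Finset.sum_congr rfl fun l _ => ?_) hone
  rw [mul_one, trace_rho_youngIdem, map_smul]
  by_cases h : dimW N l.1 = 0
  · rw [rho_youngCent_eq_zero h, smul_zero]
  · rw [mul_inv_cancel₀ (mul_ne_zero (youngScalar_ne_zero l) (by exact_mod_cast h)), one_smul]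

theorem average_eq_rho (M : TensorMatrix N d) :
    average M = rho N d (permTrace M * weingarten N d) := by
  obtain ⟨x, hx⟩ := exists_rho_eq_average M
  have hM : permTrace M = x * permTrace (1 : TensorMatrix N d) := by
    rw [← permTrace_average, ← hx, ← permTrace_rho_mul, mul_one]
  rw [hM, mul_assoc, map_mul, rho_permTrace_one_mul_weingarten, mul_one, hx]

end PermTrace

/-! ### Moments of traces -/

section Moments

open MeasureTheory

variable {N d : ℕ}

theorem sum_mul_single_mul_apply {m R : Type*} [Fintype m] [DecidableEq m] [CommSemiring R]
    (X Y : Matrix m m R) :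
    ∑ i : m, ∑ j : m, (X * Matrix.single i j (1 : R) * Y : Matrix m m R) i j =
      X.trace * Y.trace := by
  rw [Matrix.trace, Matrix.trace, Finset.sum_mul_sum]
  refine Finset.sum_congr rfl fun i _ => Finset.sum_congr rfl fun j _ => ?_
  rw [Matrix.mul_apply, Finset.sum_eq_single_of_mem j (Finset.mem_univ j)]
  · simp
  · intro k _ hk
    rw [Matrix.mul_single_apply_of_ne _ _ _ _ _ hk, zero_mul]

theorem integral_trace_conj_pow {A B : Matrix (Fin N) (Fin N) ℂ} {a b : Fin N → ℂ}
    (ha : AreEigenvalues A a) (hb : AreEigenvalues B b) (d : ℕ) :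
    ∫ u : U N, (A * u.1 * B * (u⁻¹).1).trace ^ d ∂(haarU N) =
      ∑ l : Shape d, MvPolynomial.eval a (schur N l.1) * MvPolynomial.eval b (schur N l.1) *
        (dimV l.1 / dimW N l.1) := by
  have htrace : ∀ u : U N, (A * u.1 * B * (u⁻¹).1).trace ^ d = (kronPow (Fin d) A *
      (unitaryTensor N d u * kronPow (Fin d) B * unitaryTensor N d u⁻¹)).trace := fun u => by
    simp only [unitaryTensor_apply, ← kronPow_mul, trace_kronPow, Fintype.card_fin, mul_assoc]
  simp only [htrace]
  rw [← trace_mul_average, average_eq_rho, permTrace_kronPow, sum_smul_youngCent_mul_weingarten,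
    map_sum, Finset.mul_sum, Matrix.trace_sum]
  refine Finset.sum_congr rfl fun l _ => ?_
  rw [map_smul, mul_smul_comm, ← (commute_rho_kronPow _ A).eq, Matrix.trace_smul,
    trace_rho_youngCent_mul_kronPow, trace_rho_youngIdem_mul_kronPow l ha,
    trace_rho_youngIdem_mul_kronPow l hb, smul_eq_mul]
  field_simp [youngScalar_ne_zero l]

theorem integral_trace_mul_trace (X Y : TensorMatrix N d) :
    ∫ u, (X * unitaryTensor N d u).trace * (unitaryTensor N d u⁻¹ * Y).trace ∂(haarU N) =
      ∑ J : Fin d → Fin N, ∑ K : Fin d → Fin N,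
        (X * average (Matrix.single J K (1 : ℂ)) * Y : TensorMatrix N d) J K := by
  have hint : ∀ J K : Fin d → Fin N, Integrable (fun u => (X * (unitaryTensor N d u *
      Matrix.single J K (1 : ℂ) * unitaryTensor N d u⁻¹) * Y : TensorMatrix N d) J K)
      (haarU N) := fun J K =>
    integrable_haarU_of_continuous (((continuous_const.matrix_mul
      (continuous_unitaryTensor_conj _)).matrix_mul continuous_const).matrix_elem J K)
  simp only [mul_average_mul_apply, ← integral_finsetSum _ fun K _ => hint _ K]
  rw [← integral_finsetSum _ fun J _ => integrable_finsetSum _ fun K _ => hint J K]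
  simp only [← sum_mul_single_mul_apply, mul_assoc]

theorem average_single (J K : Fin d → Fin N) :
    average (Matrix.single J K (1 : ℂ)) = ∑ g : Equiv.Perm (Fin d),
      rho N d (MonoidAlgebra.single g⁻¹ 1) K J •
        rho N d (MonoidAlgebra.single g 1 * weingarten N d) := by
  simp only [average_eq_rho, permTrace, Finset.sum_mul, map_sum, smul_mul_assoc, map_smul,
    Matrix.trace_mul_single, MulOpposite.op_one, one_smul]

theorem sum_mul_average_single_mul (X Y : TensorMatrix N d) :
    ∑ J : Fin d → Fin N, ∑ K : Fin d → Fin N,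
        (X * average (Matrix.single J K (1 : ℂ)) * Y : TensorMatrix N d) J K =
      ∑ g : Equiv.Perm (Fin d), (rho N d (MonoidAlgebra.single g⁻¹ 1) *
        (X * rho N d (MonoidAlgebra.single g 1 * weingarten N d) * Y)).trace := by
  simp only [average_single, Finset.mul_sum, Finset.sum_mul, Matrix.sum_apply, mul_smul_comm,
    smul_mul_assoc, Matrix.smul_apply, smul_eq_mul]
  rw [Finset.sum_comm, Finset.sum_congr rfl fun K _ => Finset.sum_comm, Finset.sum_comm]
  exact Finset.sum_congr rfl fun g _ => Finset.sum_congr rfl fun K _ => Matrix.mul_apply.symm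

theorem integral_trace_pow_mul_trace_pow {A B : Matrix (Fin N) (Fin N) ℂ} {c : Fin N → ℂ}
    (hc : AreEigenvalues (A * B) c) (d : ℕ) :
    ∫ u : U N, (A * u.1).trace ^ d * (B * (u⁻¹).1).trace ^ d ∂(haarU N) =
      ∑ l : Shape d, MvPolynomial.eval c (schur N l.1) * (dimV l.1 ^ 2 / dimW N l.1) := by
  have htrace : ∀ u : U N, (A * u.1).trace ^ d * (B * (u⁻¹).1).trace ^ d =
      (kronPow (Fin d) A * unitaryTensor N d u).trace *
        (unitaryTensor N d u⁻¹ * kronPow (Fin d) B).trace := fun u => by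
    simp only [unitaryTensor_apply, ← kronPow_mul, trace_kronPow, Fintype.card_fin,
      Matrix.trace_mul_comm B]
  have hterm : ∀ g : Equiv.Perm (Fin d), rho N d (MonoidAlgebra.single g⁻¹ 1) *
      (kronPow (Fin d) A * rho N d (MonoidAlgebra.single g 1 * weingarten N d) *
        kronPow (Fin d) B) = rho N d (weingarten N d) * kronPow (Fin d) (A * B) := fun g => by
    rw [← (commute_rho_kronPow _ A).eq, kronPow_mul, ← mul_assoc, ← mul_assoc, ← map_mul,
      ← mul_assoc, MonoidAlgebra.single_mul_single, inv_mul_cancel, mul_one,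
      ← MonoidAlgebra.one_def, one_mul, mul_assoc]
  simp only [htrace, integral_trace_mul_trace, sum_mul_average_single_mul, hterm]
  rw [Finset.sum_const, Finset.card_univ, Fintype.card_perm, Fintype.card_fin, nsmul_eq_mul,
    weingarten, map_sum, Finset.sum_mul, Matrix.trace_sum, Finset.mul_sum]
  have hd : (d.factorial : ℂ) ≠ 0 := Nat.cast_ne_zero.2 d.factorial_ne_zero
  refine Finset.sum_congr rfl fun l _ => ?_
  rw [map_smul, smul_mul_assoc, Matrix.trace_smul, trace_rho_youngCent_mul_kronPow,
    trace_rho_youngIdem_mul_kronPow l hc, mul_inv, ← youngIdem_coeff_one, youngIdem_coeff_one_eq,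
    smul_eq_mul]
  field_simp

end Moments

/-! ### Bounds on the terms -/

section Bounds

variable {N d : ℕ}

theorem mem_diagrams {lam : YoungDiagram} :
    lam ∈ diagrams N d ↔ lam.card = d ∧ numRows lam ≤ N := by
  rw [diagrams, Set.Finite.mem_toFinset, Set.mem_ofPred_eq]

theorem sum_diagrams_eq_sum_shape {α : Type*} [AddCommMonoid α] (F : YoungDiagram → α)
    (hF : ∀ lam, dimW N lam = 0 → F lam = 0) :
    ∑ lam ∈ diagrams N d, F lam = ∑ l : Shape d, F l.1 := by
  refine Finset.sum_bij_ne_zero (fun lam h _ => ⟨lam, (mem_diagrams.1 h).1⟩)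
    (fun _ _ _ => Finset.mem_univ _) (fun _ _ _ _ _ _ h => congrArg Subtype.val h)
    (fun l _ hl => ⟨l.1, mem_diagrams.2 ⟨l.2, ?_⟩, hl, rfl⟩) fun _ _ _ => rfl
  by_contra h
  exact hl (hF l.1 (dimW_eq_zero (not_le.1 h)))

theorem hcizTerm_eq_sum (d : ℕ) (p : ℂ × (Fin N → ℂ) × (Fin N → ℂ)) :
    hcizTerm N d p = ∑ lam ∈ diagrams N d, hcizDiagramTerm N lam p := by
  rw [hcizTerm, Finset.mul_sum]
  refine Finset.sum_congr rfl fun lam h => ?_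
  rw [hcizDiagramTerm, (mem_diagrams.1 h).1]

theorem bgwTerm_eq_sum (d : ℕ) (p : ℂ × (Fin N → ℂ)) :
    bgwTerm N d p = ∑ lam ∈ diagrams N d, bgwDiagramTerm N lam p := by
  rw [bgwTerm, Finset.mul_sum]
  refine Finset.sum_congr rfl fun lam h => ?_
  rw [bgwDiagramTerm, (mem_diagrams.1 h).1]

theorem dimV_le {lam : YoungDiagram} (h : dimW N lam ≠ 0) : dimV lam ≤ N ^ lam.card := by
  rw [← sum_dimV_mul_dimW N lam.card]
  exact (Nat.le_mul_of_pos_right _ (Nat.pos_of_ne_zero h)).trans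
    (Finset.single_le_sum (f := fun l : Shape lam.card => dimV l.1 * dimW N l.1)
      (fun _ _ => Nat.zero_le _) (Finset.mem_univ ⟨lam, rfl⟩))

theorem card_shape_dimW_ne_zero_le (N d : ℕ) :
    (Finset.univ.filter fun l : Shape d => dimW N l.1 ≠ 0).card ≤ N ^ d := by
  rw [← sum_dimV_mul_dimW N d, Finset.card_filter]
  refine Finset.sum_le_sum fun l _ => ?_
  split_ifs with h
  · exact Nat.mul_pos (dimV_pos l.1) (Nat.pos_of_ne_zero h)
  · exact Nat.zero_le _

theorem norm_eval_psumPart_le (g : Equiv.Perm (Fin d)) {a : Fin N → ℂ} {R : ℝ}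
    (ha : ∀ i, ‖a i‖ ≤ R) :
    ‖MvPolynomial.eval a (MvPolynomial.psumPart (Fin N) ℂ g.partition)‖ ≤ N ^ d * R ^ d := by
  rw [← sum_invariant_eq_psumPart]
  have hprod : ∀ J : Fin d → Fin N, ‖∏ k, a (J k)‖ ≤ R ^ d := fun J => by
    rw [norm_prod]
    refine (Finset.prod_le_prod (fun _ _ => norm_nonneg _) fun k _ => ha (J k)).trans_eq ?_
    rw [Finset.prod_const, Finset.card_univ, Fintype.card_fin]
  calc _ ≤ ∑ J : Fin d → Fin N, ‖∏ k, a (J k)‖ :=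
      (norm_sum_le _ _).trans (Finset.sum_le_univ_sum_of_nonneg fun _ => norm_nonneg _)
    _ ≤ ∑ _J : Fin d → Fin N, R ^ d := Finset.sum_le_sum fun J _ => hprod J
    _ = N ^ d * R ^ d := by simp

theorem norm_eval_schur_le (lam : YoungDiagram) {a : Fin N → ℂ} {R : ℝ} (ha : ∀ i, ‖a i‖ ≤ R) :
    ‖MvPolynomial.eval a (schur N lam)‖ ≤ dimV lam * (N ^ lam.card * R ^ lam.card) := by
  have hd : (0 : ℝ) < lam.card.factorial := by exact_mod_cast lam.card.factorial_pos
  have hterm : ∀ g ∈ (Finset.univ : Finset (Equiv.Perm (Fin lam.card))),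
      ‖MvPolynomial.eval a (MvPolynomial.C ((Vrep lam).character g) *
        MvPolynomial.psumPart (Fin N) ℂ g.partition)‖ ≤
      dimV lam * (N ^ lam.card * R ^ lam.card) := fun g _ => by
    rw [map_mul, MvPolynomial.eval_C, norm_mul]
    exact mul_le_mul (norm_character_Vrep_le lam g) (norm_eval_psumPart_le g ha) (norm_nonneg _)
      (Nat.cast_nonneg _)
  rw [schur, map_mul, MvPolynomial.eval_C, map_sum, norm_mul, norm_inv, RCLike.norm_natCast,
    inv_mul_le_iff₀ hd]
  refine (norm_sum_le_of_le _ hterm).trans_eq ?_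
  rw [Finset.sum_const, Finset.card_univ, Fintype.card_perm, Fintype.card_fin, nsmul_eq_mul]

theorem norm_eval_schur_le_pow {lam : YoungDiagram} (h : dimW N lam ≠ 0) {a : Fin N → ℂ} {R : ℝ}
    (hR : 0 ≤ R) (ha : ∀ i, ‖a i‖ ≤ R) :
    ‖MvPolynomial.eval a (schur N lam)‖ ≤ N ^ (2 * lam.card) * R ^ lam.card := by
  have hV : (dimV lam : ℝ) ≤ N ^ lam.card := by exact_mod_cast dimV_le h
  calc _ ≤ (dimV lam : ℝ) * (N ^ lam.card * R ^ lam.card) := norm_eval_schur_le lam ha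
    _ ≤ N ^ lam.card * (N ^ lam.card * R ^ lam.card) := by gcongr
    _ = N ^ (2 * lam.card) * R ^ lam.card := by ring

theorem norm_dimV_pow_div_dimW_le {lam : YoungDiagram} (h : dimW N lam ≠ 0) (k : ℕ) :
    ‖(dimV lam : ℂ) ^ k / (dimW N lam : ℂ)‖ ≤ N ^ (k * lam.card) := by
  have hV : (dimV lam : ℝ) ≤ N ^ lam.card := by exact_mod_cast dimV_le h
  have hW : (1 : ℝ) ≤ dimW N lam := by exact_mod_cast Nat.pos_of_ne_zero h
  rw [norm_div, norm_pow, RCLike.norm_natCast, RCLike.norm_natCast, mul_comm k, pow_mul]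
  exact (div_le_self (by positivity) hW).trans (by gcongr)

/-- A bound on the terms indexed by `lam` of both expansions over the ball of radius `R`. The
terms with `dimW N lam = 0` vanish, and only those are not controlled by `dimV_le`. -/
def majorant (N : ℕ) (R : ℝ) (lam : YoungDiagram) : ℝ :=
  if dimW N lam = 0 then 0 else (R ^ 3 * N ^ 6) ^ lam.card / lam.card.factorial

theorem norm_hcizDiagramTerm_le {R : ℝ} (lam : YoungDiagram)
    {p : ℂ × (Fin N → ℂ) × (Fin N → ℂ)} (hp : ‖p‖ ≤ R) :
    ‖hcizDiagramTerm N lam p‖ ≤ majorant N R lam := by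
  rw [majorant, hcizDiagramTerm]
  split_ifs with h
  · rw [h, Nat.cast_zero, div_zero, mul_zero, mul_zero, norm_zero]
  have hR : 0 ≤ R := (norm_nonneg p).trans hp
  have hz : ‖p.1‖ ≤ R := (norm_fst_le p).trans hp
  have ha : ∀ i, ‖p.2.1 i‖ ≤ R := fun i =>
    (norm_le_pi_norm _ i).trans ((norm_fst_le p.2).trans ((norm_snd_le p).trans hp))
  have hb : ∀ i, ‖p.2.2 i‖ ≤ R := fun i =>
    (norm_le_pi_norm _ i).trans ((norm_snd_le p.2).trans ((norm_snd_le p).trans hp))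
  have hVW := norm_dimV_pow_div_dimW_le h 1
  rw [pow_one] at hVW
  simp only [norm_mul, norm_div _ (Nat.cast (Nat.factorial _)), norm_pow, RCLike.norm_natCast]
  calc _ ≤ R ^ lam.card / lam.card.factorial * N ^ lam.card *
        (N ^ (2 * lam.card) * R ^ lam.card * (N ^ (2 * lam.card) * R ^ lam.card) *
          N ^ (1 * lam.card)) := by
        gcongr
        · exact norm_eval_schur_le_pow h hR ha
        · exact norm_eval_schur_le_pow h hR hb
    _ = _ := by rw [mul_pow, ← pow_mul, ← pow_mul]; ring

theorem norm_bgwDiagramTerm_le {R : ℝ} (lam : YoungDiagram)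
    {p : ℂ × (Fin N → ℂ)} (hp : ‖p‖ ≤ R) :
    ‖bgwDiagramTerm N lam p‖ ≤ majorant N R lam := by
  rw [majorant, bgwDiagramTerm]
  split_ifs with h
  · rw [h, Nat.cast_zero, div_zero, mul_zero, mul_zero, norm_zero]
  have hR : 0 ≤ R := (norm_nonneg p).trans hp
  have hz : ‖p.1‖ ≤ R := (norm_fst_le p).trans hp
  have hc : ∀ i, ‖p.2 i‖ ≤ R := fun i => (norm_le_pi_norm _ i).trans ((norm_snd_le p).trans hp)
  have hd : (1 : ℝ) ≤ lam.card.factorial := by exact_mod_cast lam.card.factorial_pos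
  simp only [norm_mul, norm_div _ (Nat.cast (Nat.factorial _) * Nat.cast (Nat.factorial _)),
    norm_pow (p.1), norm_pow (N : ℂ), RCLike.norm_natCast]
  calc _ ≤ R ^ (2 * lam.card) / (1 * lam.card.factorial) * N ^ (2 * lam.card) *
        (N ^ (2 * lam.card) * R ^ lam.card * N ^ (2 * lam.card)) := by
        gcongr
        · exact norm_eval_schur_le_pow h hR hc
        · exact norm_dimV_pow_div_dimW_le h 2
    _ = _ := by rw [mul_pow, ← pow_mul, ← pow_mul]; ring

theorem majorant_nonneg {R : ℝ} (hR : 0 ≤ R) (lam : YoungDiagram) : 0 ≤ majorant N R lam := by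
  rw [majorant]
  split_ifs
  · exact le_rfl
  · positivity

theorem sum_majorant_le {R : ℝ} (hR : 0 ≤ R) (N d : ℕ) :
    ∑ l : Shape d, majorant N R l.1 ≤ (N * (R ^ 3 * N ^ 6)) ^ d / d.factorial := by
  have hmaj : ∀ l : Shape d, majorant N R l.1 =
      if dimW N l.1 ≠ 0 then (R ^ 3 * N ^ 6) ^ d / d.factorial else 0 := fun l => by
    rw [majorant, l.2, ite_not]
  simp only [hmaj]
  rw [← Finset.sum_filter, Finset.sum_const, nsmul_eq_mul, mul_pow (N : ℝ), mul_div_assoc]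
  gcongr
  exact_mod_cast card_shape_dimW_ne_zero_le N d

theorem summable_majorant {R : ℝ} (hR : 0 ≤ R) (N : ℕ) : Summable (majorant N R) := by
  rw [← (Equiv.sigmaFiberEquiv YoungDiagram.card).summable_iff]
  refine (summable_sigma_of_nonneg fun x => majorant_nonneg hR _).2
    ⟨fun d => summable_of_hasFiniteSupport (Set.toFinite _), ?_⟩
  refine Summable.of_nonneg_of_le (fun d => tsum_nonneg fun _ => majorant_nonneg hR _)
    (fun d => ?_) (Real.summable_pow_div_factorial (N * (R ^ 3 * N ^ 6)))
  rw [tsum_fintype]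
  exact sum_majorant_le hR N d

theorem norm_sum_diagrams_le {R : ℝ} {F : YoungDiagram → ℂ} (hR : 0 ≤ R)
    (hF : ∀ lam, ‖F lam‖ ≤ majorant N R lam) (d : ℕ) :
    ‖∑ lam ∈ diagrams N d, F lam‖ ≤ (N * (R ^ 3 * N ^ 6)) ^ d / d.factorial := by
  refine (norm_sum_le_of_le _ fun lam _ => hF lam).trans ?_
  rw [sum_diagrams_eq_sum_shape (majorant N R) fun lam h => by rw [majorant, if_pos h]]
  exact sum_majorant_le hR N d

end Bounds

/-! ### Convergence -/

section Convergence

variable {X : Type*} [NormedAddCommGroup X]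

theorem seriesConverges_of_norm_le {f : ℕ → X → ℂ} (Q : ℝ → ℝ)
    (hf : ∀ R p d, ‖p‖ ≤ R → ‖f d p‖ ≤ Q R ^ d / d.factorial) : SeriesConverges f := by
  have hQ : ∀ R, Summable fun d : ℕ => Q R ^ (d + 1) / (d + 1).factorial := fun R =>
    (summable_nat_add_iff 1).2 (Real.summable_pow_div_factorial (Q R))
  refine ⟨fun p => Summable.of_nonneg_of_le (fun _ => norm_nonneg _)
    (fun d => hf ‖p‖ p (d + 1) le_rfl) (hQ _), fun K hK => ?_⟩
  obtain ⟨R, hR⟩ := hK.isBounded.exists_norm_le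
  have htail := tendstoUniformlyOn_tsum_nat (f := fun d p => f (d + 1) p) (hQ R)
    (s := K) fun d p hp => hf R p (d + 1) (hR p hp)
  rw [Metric.tendstoUniformlyOn_iff] at htail ⊢
  simpa only [dist_add_left] using htail

theorem summableUniformlyOn_norm_of_le_majorant {N : ℕ} {F : YoungDiagram → X → ℂ}
    (hF : ∀ R lam p, ‖p‖ ≤ R → ‖F lam p‖ ≤ majorant N R lam) {K : Set X} (hK : IsCompact K) :
    SummableUniformlyOn (fun (lam : {lam : YoungDiagram // numRows lam ≤ N}) p => ‖F lam p‖) K := by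
  obtain ⟨R, hR0, hR⟩ := hK.isBounded.exists_pos_norm_le
  refine (HasSumUniformlyOn.of_norm_le_summable
    ((summable_majorant hR0.le N).subtype _) fun lam p hp => ?_).summableUniformlyOn
  rw [norm_norm]
  exact hF R lam p (hR p hp)

end Convergence

/-! ### The expansions -/

section Expansions

open MeasureTheory

theorem hasSum_integral_of_norm_le {X ι : Type*} [MeasurableSpace X] [Countable ι] {μ : Measure X}
    [IsFiniteMeasure μ] {F : ι → X → ℂ} {f : X → ℂ} {b : ι → ℝ}
    (hF : ∀ i, AEStronglyMeasurable (F i) μ) (hFb : ∀ i x, ‖F i x‖ ≤ b i) (hb : Summable b)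
    (hf : ∀ x, HasSum (fun i => F i x) (f x)) :
    HasSum (fun i => ∫ x, F i x ∂μ) (∫ x, f x ∂μ) :=
  hasSum_integral_of_dominated_convergence (fun i _ => b i) hF (fun i => .of_forall (hFb i))
    (.of_forall fun _ => hb) (integrable_const _) (.of_forall hf)

theorem hasSum_pow_div_factorial (x : ℂ) :
    HasSum (fun n : ℕ => x ^ n / n.factorial) (Complex.exp x) := by
  rw [Complex.exp_eq_exp_ℂ]
  exact NormedSpace.expSeries_div_hasSum_exp x

theorem hasSum_pow_div_factorial_mul (x y : ℂ) :
    HasSum (fun n : ℕ × ℕ => x ^ n.1 / n.1.factorial * (y ^ n.2 / n.2.factorial))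
      (Complex.exp (x + y)) := by
  have hsum : ∀ x : ℂ, Summable fun n : ℕ => ‖x ^ n / (n.factorial : ℂ)‖ :=
    NormedSpace.norm_expSeries_div_summable
  have hprod := summable_mul_of_summable_norm (hsum x) (hsum y)
  have h := (hasSum_pow_div_factorial x).mul (hasSum_pow_div_factorial y) hprod
  rwa [← Complex.exp_add] at h

variable {N : ℕ}

theorem exists_norm_le_of_continuous {X : U N → ℂ} (hX : Continuous X) :
    ∃ C, 0 ≤ C ∧ ∀ u, ‖X u‖ ≤ C := by
  obtain ⟨C, hC⟩ := (isCompact_univ (X := U N)).exists_bound_of_continuousOn hX.continuousOn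
  exact ⟨C, (norm_nonneg _).trans (hC 1 (Set.mem_univ _)), fun u => hC u (Set.mem_univ u)⟩

theorem norm_pow_div_factorial_le {x : ℂ} {C : ℝ} (hx : ‖x‖ ≤ C) (n : ℕ) :
    ‖x ^ n / n.factorial‖ ≤ C ^ n / n.factorial := by
  rw [norm_div, norm_pow, RCLike.norm_natCast]
  gcongr

theorem hasSum_integral_pow {X : U N → ℂ} (hX : Continuous X) :
    HasSum (fun n : ℕ => ∫ u, X u ^ n / n.factorial ∂(haarU N))
      (∫ u, Complex.exp (X u) ∂(haarU N)) := by
  obtain ⟨C, -, hC⟩ := exists_norm_le_of_continuous hX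
  have hcont : ∀ n : ℕ, Continuous fun u => X u ^ n / (n.factorial : ℂ) := fun n =>
    (hX.pow n).div_const _
  have hsum := Real.summable_pow_div_factorial C
  exact hasSum_integral_of_norm_le
    (fun n => (integrable_haarU_of_continuous (hcont n)).aestronglyMeasurable)
    (fun n u => norm_pow_div_factorial_le (hC u) n) hsum fun u => hasSum_pow_div_factorial (X u)

theorem hasSum_integral_pow_mul_pow {X Y : U N → ℂ} (hX : Continuous X) (hY : Continuous Y) :
    HasSum (fun n : ℕ × ℕ =>
        ∫ u, X u ^ n.1 / n.1.factorial * (Y u ^ n.2 / n.2.factorial) ∂(haarU N))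
      (∫ u, Complex.exp (X u + Y u) ∂(haarU N)) := by
  obtain ⟨C, hC0, hC⟩ := exists_norm_le_of_continuous hX
  obtain ⟨C', hC'0, hC'⟩ := exists_norm_le_of_continuous hY
  have hcont : ∀ n : ℕ × ℕ, Continuous fun u =>
      X u ^ n.1 / (n.1.factorial : ℂ) * (Y u ^ n.2 / (n.2.factorial : ℂ)) := fun n =>
    ((hX.pow n.1).div_const _).mul ((hY.pow n.2).div_const _)
  have hbound : ∀ (n : ℕ × ℕ) u,
      ‖X u ^ n.1 / (n.1.factorial : ℂ) * (Y u ^ n.2 / (n.2.factorial : ℂ))‖ ≤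
        C ^ n.1 / n.1.factorial * (C' ^ n.2 / n.2.factorial) := fun n u =>
    norm_mul_le_of_le (norm_pow_div_factorial_le (hC u) _) (norm_pow_div_factorial_le (hC' u) _)
  have hsum : Summable fun n : ℕ × ℕ =>
      C ^ n.1 / n.1.factorial * (C' ^ n.2 / n.2.factorial) := by
    have hs := Real.summable_pow_div_factorial C
    have hs' := Real.summable_pow_div_factorial C'
    exact hs.mul_of_nonneg hs' (fun n => by positivity) fun n => by positivity
  exact hasSum_integral_of_norm_le
    (fun n => (integrable_haarU_of_continuous (hcont n)).aestronglyMeasurable) hbound hsum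
    fun u => hasSum_pow_div_factorial_mul (X u) (Y u)

theorem continuous_trace_mul (A : Matrix (Fin N) (Fin N) ℂ) :
    Continuous fun u : U N => (A * u.1).trace :=
  (continuous_const.matrix_mul continuous_subtype_val).matrix_trace

theorem continuous_trace_mul_inv (B : Matrix (Fin N) (Fin N) ℂ) :
    Continuous fun u : U N => (B * (u⁻¹).1).trace :=
  (continuous_trace_mul B).comp continuous_inv

theorem continuous_trace_conj (A B : Matrix (Fin N) (Fin N) ℂ) :
    Continuous fun u : U N => (A * u.1 * B * (u⁻¹).1).trace :=
  (((continuous_const.matrix_mul continuous_subtype_val).matrix_mul continuous_const).matrix_mul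
    (continuous_subtype_val.comp continuous_inv)).matrix_trace

theorem eq_add_tsum_succ_of_hasSum {f : ℕ → ℂ} {s : ℂ} (hf : HasSum f s) :
    s = f 0 + ∑' d, f (d + 1) := by
  rw [← hf.tsum_eq, hf.summable.tsum_eq_zero_add]

theorem integral_pow_div_factorial_eq_hcizTerm (z : ℂ) {A B : Matrix (Fin N) (Fin N) ℂ}
    {a b : Fin N → ℂ} (ha : AreEigenvalues A a) (hb : AreEigenvalues B b) (d : ℕ) :
    ∫ u : U N, (z * N * (A * u.1 * B * (u⁻¹).1).trace) ^ d / d.factorial ∂(haarU N) =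
      hcizTerm N d (z, a, b) := by
  simp only [mul_pow, mul_div_right_comm _ _ (d.factorial : ℂ)]
  rw [integral_const_mul, integral_trace_conj_pow ha hb, hcizTerm, sum_diagrams_eq_sum_shape]
  intro lam h
  rw [h, Nat.cast_zero, div_zero, mul_zero]

theorem hciz_eq (z : ℂ) {A B : Matrix (Fin N) (Fin N) ℂ} {a b : Fin N → ℂ}
    (ha : AreEigenvalues A a) (hb : AreEigenvalues B b) :
    hciz N z A B = 1 + ∑' d : ℕ, hcizTerm N (d + 1) (z, a, b) := by
  have hsum : HasSum (fun d => hcizTerm N d (z, a, b)) (hciz N z A B) := by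
    simp only [← integral_pow_div_factorial_eq_hcizTerm z ha hb]
    exact hasSum_integral_pow (continuous_const.mul (continuous_trace_conj A B))
  have hzero : hcizTerm N 0 (z, a, b) = 1 := by
    rw [← integral_pow_div_factorial_eq_hcizTerm z ha hb]
    simp
  rw [eq_add_tsum_succ_of_hasSum hsum, hzero]

theorem exists_unitary_pow_mul_star_pow_eq_neg_one {p q : ℕ} (hpq : p ≠ q) :
    ∃ ζ : unitary ℂ, (ζ : ℂ) ^ p * star (ζ : ℂ) ^ q = -1 := by
  let θ : ℝ := Real.pi / ((p : ℝ) - q)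
  have hne : ((p : ℂ) - q) ≠ 0 := sub_ne_zero.2 (by exact_mod_cast hpq)
  have hstar : star (Complex.exp (θ * Complex.I)) = Complex.exp (-(θ * Complex.I)) := by
    rw [← starRingEnd_apply, ← Complex.exp_conj, map_mul, Complex.conj_ofReal, Complex.conj_I,
      mul_neg]
  have hmem : Complex.exp (θ * Complex.I) ∈ unitary ℂ := by
    rw [Unitary.mem_iff_star_mul_self, hstar, ← Complex.exp_add, neg_add_cancel, Complex.exp_zero]
  refine ⟨⟨_, hmem⟩, ?_⟩
  rw [hstar, ← Complex.exp_nat_mul, ← Complex.exp_nat_mul, ← Complex.exp_add,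
    ← Complex.exp_pi_mul_I]
  congr 1
  simp only [θ, Complex.ofReal_div, Complex.ofReal_sub, Complex.ofReal_natCast]
  field_simp
  ring

theorem integral_haarU_smul (f : U N → ℂ) (ζ : unitary ℂ) :
    ∫ u, f (ζ • u) ∂(haarU N) = ∫ u, f u ∂(haarU N) := by
  have hmul : ∀ u : U N, ζ • (1 : U N) * u = ζ • u := fun u =>
    Subtype.ext ((smul_mul_assoc _ _ _).trans (congrArg _ (one_mul u.1)))
  rw [← integral_mul_left_eq_self f (ζ • (1 : U N))]
  simp only [hmul]

theorem integral_trace_pow_mul_trace_pow_of_ne (A B : Matrix (Fin N) (Fin N) ℂ) {p q : ℕ}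
    (hpq : p ≠ q) :
    ∫ u : U N, (A * u.1).trace ^ p * (B * (u⁻¹).1).trace ^ q ∂(haarU N) = 0 := by
  obtain ⟨ζ, hζ⟩ := exists_unitary_pow_mul_star_pow_eq_neg_one hpq
  have hinv : ∀ u : U N, ((ζ • u)⁻¹).1 = star (ζ : ℂ) • (u⁻¹).1 := fun u => star_smul (ζ : ℂ) u.1
  have hscale : ∀ u : U N, (A * (ζ • u).1).trace ^ p * (B * ((ζ • u)⁻¹).1).trace ^ q =
      -((A * u.1).trace ^ p * (B * (u⁻¹).1).trace ^ q) := fun u => by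
    rw [hinv, Unitary.coe_smul, Submonoid.smul_def, mul_smul_comm, mul_smul_comm, Matrix.trace_smul,
      Matrix.trace_smul, smul_eq_mul, smul_eq_mul, mul_pow, mul_pow, mul_mul_mul_comm, hζ,
      neg_one_mul]
  have h := integral_haarU_smul
    (fun u => (A * u.1).trace ^ p * (B * (u⁻¹).1).trace ^ q) ζ
  simp only [hscale, integral_neg] at h
  exact self_eq_neg.1 h.symm

theorem hasSum_bgw (z : ℂ) (A B : Matrix (Fin N) (Fin N) ℂ) :
    HasSum (fun n : ℕ × ℕ => (z * N) ^ n.1 / n.1.factorial * ((z * N) ^ n.2 / n.2.factorial) *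
      ∫ u : U N, (A * u.1).trace ^ n.1 * (B * (u⁻¹).1).trace ^ n.2 ∂(haarU N))
      (bgw N z A B) := by
  have h := hasSum_integral_pow_mul_pow (X := fun u : U N => z * N * (A * u.1).trace)
    (Y := fun u => z * N * (B * (u⁻¹).1).trace) (continuous_const.mul (continuous_trace_mul A))
    (continuous_const.mul (continuous_trace_mul_inv B))
  simp only [← mul_add, ← Matrix.trace_add] at h
  rw [bgw]
  convert h using 2 with n
  rw [← integral_const_mul]
  refine integral_congr_ae (.of_forall fun u => ?_)
  simp only [mul_pow]
  ring

theorem integral_eq_bgwTerm (z : ℂ) {A B : Matrix (Fin N) (Fin N) ℂ} {c : Fin N → ℂ}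
    (hc : AreEigenvalues (A * B) c) (d : ℕ) :
    (z * N) ^ d / d.factorial * ((z * N) ^ d / d.factorial) *
      ∫ u : U N, (A * u.1).trace ^ d * (B * (u⁻¹).1).trace ^ d ∂(haarU N) =
        bgwTerm N d (z, c) := by
  rw [integral_trace_pow_mul_trace_pow hc, bgwTerm, sum_diagrams_eq_sum_shape]
  · ring
  · intro lam h
    rw [h, Nat.cast_zero, div_zero, mul_zero]

theorem bgw_eq (z : ℂ) {A B : Matrix (Fin N) (Fin N) ℂ} {c : Fin N → ℂ}
    (hc : AreEigenvalues (A * B) c) :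
    bgw N z A B = 1 + ∑' d : ℕ, bgwTerm N (d + 1) (z, c) := by
  have hdiag : Function.Injective fun d : ℕ => (d, d) := fun _ _ h => congrArg Prod.fst h
  have hsum : HasSum (fun d => bgwTerm N d (z, c)) (bgw N z A B) := by
    simp only [← integral_eq_bgwTerm z hc]
    refine (hdiag.hasSum_iff ?_).2 (hasSum_bgw z A B)
    rintro ⟨p, q⟩ hpq
    have hne : p ≠ q := fun e => hpq ⟨p, by rw [e]⟩
    rw [integral_trace_pow_mul_trace_pow_of_ne A B hne, mul_zero]
  have hzero : bgwTerm N 0 (z, c) = 1 := by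
    rw [← integral_eq_bgwTerm z hc]
    simp
  rw [eq_add_tsum_succ_of_hasSum hsum, hzero]

end Expansions

end CharExp

end

theorem theorem2p1 (N : ℕ) :
    -- the HCIZ expansion
    (∀ (z : ℂ) (A B : Matrix (Fin N) (Fin N) ℂ) (a b : Fin N → ℂ),
      CharExp.AreEigenvalues A a → CharExp.AreEigenvalues B b →
        CharExp.hciz N z A B = 1 + ∑' d : ℕ, CharExp.hcizTerm N (d + 1) (z, a, b)) ∧
    -- the BGW expansion
    (∀ (z : ℂ) (A B : Matrix (Fin N) (Fin N) ℂ) (c : Fin N → ℂ),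
      CharExp.AreEigenvalues (A * B) c →
        CharExp.bgw N z A B = 1 + ∑' d : ℕ, CharExp.bgwTerm N (d + 1) (z, c)) ∧
    -- absolute convergence, uniform on compact sets, of both series
    CharExp.SeriesConverges (CharExp.hcizTerm N) ∧
    CharExp.SeriesConverges (CharExp.bgwTerm N) ∧
    -- the same when the series are read as series over Young diagrams with at most `N` rows
    (∀ K : Set (ℂ × (Fin N → ℂ) × (Fin N → ℂ)), IsCompact K →
      SummableUniformlyOn (fun (lam : {lam : YoungDiagram // CharExp.numRows lam ≤ N}) p =>
        ‖CharExp.hcizDiagramTerm N lam p‖) K) ∧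
    (∀ K : Set (ℂ × (Fin N → ℂ)), IsCompact K →
      SummableUniformlyOn (fun (lam : {lam : YoungDiagram // CharExp.numRows lam ≤ N}) p =>
        ‖CharExp.bgwDiagramTerm N lam p‖) K) := by
  refine ⟨fun z A B a b ha hb => CharExp.hciz_eq z ha hb, fun z A B c hc => CharExp.bgw_eq z hc,
    ?_, ?_, fun K hK => ?_, fun K hK => ?_⟩
  · refine CharExp.seriesConverges_of_norm_le (fun R => N * (R ^ 3 * N ^ 6)) fun R p d hp => ?_
    rw [CharExp.hcizTerm_eq_sum]
    exact CharExp.norm_sum_diagrams_le ((norm_nonneg p).trans hp)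
      (fun lam => CharExp.norm_hcizDiagramTerm_le lam hp) d
  · refine CharExp.seriesConverges_of_norm_le (fun R => N * (R ^ 3 * N ^ 6)) fun R p d hp => ?_
    rw [CharExp.bgwTerm_eq_sum]
    exact CharExp.norm_sum_diagrams_le ((norm_nonneg p).trans hp)
      (fun lam => CharExp.norm_bgwDiagramTerm_le lam hp) d
  · exact CharExp.summableUniformlyOn_norm_of_le_majorant
      (fun R lam p hp => CharExp.norm_hcizDiagramTerm_le lam hp) hK
  · exact CharExp.summableUniformlyOn_norm_of_le_majorant
      (fun R lam p hp => CharExp.norm_bgwDiagramTerm_le lam hp) hK
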